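/- **Setting.** Let $H^5$ be the hypercube graph on $\{0,1\}^5$. An edge along which coordinate $j$ changes has color $j$, and the colors are cyclically ordered (the rainbow) as $(1,2,3,4,5)$, with indices modulo 5. A vertex is white if it has an odd number of entries 1, and black otherwise. A *height function* is a map $h:\{0,1\}^5\to\mathbb Z_{\ge 0}$ with $|h(v)-h(w)|=1$ for adjacent $v,w$. It is *fully extended* if $\max_{v,w}|h(v)-h(w)|$ is maximal among all height functions. We say that $h'$ is obtained from $h$ by *lowering* $v$ (and $h$ from $h'$ by *raising* $v$) if $h'(v)=h(v)-2$ and $h'=h$ at all other vertices. A *face* is a 4-cycle with two consecutive colors $j,j+1$; it is a *bow tie* for $h$ if $h$ takes exactly two values on it. **The curve.** Let $\phi=\frac{1+\sqrt5}{2}$, $\zeta=e^{2\pi i/10}$ and $\eta(z)=\frac{z-\zeta}{z-\zeta^{-1}}\cdot\frac{\zeta^3-\zeta^{-1}}{\zeta-\zeta^3}$. Let $X\subset\mathbb P^4(\mathbb C)$ be the curve $$x_1^2+x_2^2+x_3^2=0,\qquad \phi x_1^2+x_2^2+x_4^2=0,\qquad (1+\phi)x_1^2+x_2^2+x_5^2=0,$$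 and let $\pi:X\to\mathbb P^1$, $\pi([x_1:\dots:x_5])=x_2^2/x_1^2$. An *embedding* of $H^5$ in $X$ sends each vertex and each face (its *face center*) to a point of $X$ such that: for a black vertex $v$ and its neighbor $w$ along color $j$, the images of $v,w$ are joined by a path in $X$ lying over $t\mapsto\eta(t\zeta^{2j})$, $t\in[0,\infty]$, from $t=0$ to $t=\infty$; and the image of each corner $v$ of a face with colors $j,j+1$ is joined to the face center by a path in $X$ lying over $t\mapsto\eta(t\zeta^{2j+1})$, $t$ running from $0$ to $1$ if $v$ is black and from $\infty$ to $1$ if $v$ is white. **The Morse divisor.** Given an embedding, the divisor $D_h$ on $X$ attached to $h$ is the sum of the following: each vertex $v$ with coefficient $\lambda_v/2-1$, where $v_j$ is the neighbor of $v$ along color $j$ and $\lambda_v$ is the number of sign changes in the cyclic sequence $h(v_1)-h(v),\dots,h(v_5)-h(v)$; and the center of each bow-tie face, which is a saddle point whose value is the average of $h$ over the four corners, with the coefficient given by the same rule, the neighbors being the four corners in cyclic order. **The elliptic curves.** Let $E_k: y^2=x(x-1)(x-r_k)$ over $\mathbb C$, with $(r_1,\dots,r_5)=(\phi+1,\phi,-\phi,\phi+1,\phi)$,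 and define $\nu_k:X\to E_k$ by $$\nu_1=\Big(-(2\phi+1)\tfrac{x_1^2}{x_5^2}-\phi,\ (2\phi+1)\tfrac{x_2x_3x_4}{x_5^3}\Big),\quad \nu_2=\Big(\tfrac{x_2^2}{x_1^2}+\phi+1,\ i\tfrac{x_3x_4x_5}{x_1^3}\Big),$$ $$\nu_3=\Big((2\phi+1)\tfrac{x_3^2}{x_2^2}+\phi+1,\ i(2\phi+1)\tfrac{x_1x_4x_5}{x_2^3}\Big),\quad \nu_4=\Big((\phi+1)\tfrac{x_4^2}{x_3^2}-\phi,\ i\phi\tfrac{x_1x_2x_5}{x_3^3}\Big),$$ $$\nu_5=\Big(-\tfrac{x_5^2}{x_4^2}+\phi+1,\ i\tfrac{x_1x_2x_3}{x_4^3}\Big),$$ where the zeros of the denominators are sent to the point at infinity. Extend $\nu_k$ additively to divisors and put $\nu_k(h)=\nu_k(D_h)\in E_k$. (These maps realize the isogenous decomposition of the Jacobian of $X$ as $E_1\times\dots\times E_5$.) **Theorem.** Embeddings of $H^5$ in $X$ exist. Fix any embedding, let $h_1$ be obtained from a fully extended height function by lowering its top vertex, and let $1\le k\le 5$. Then $$\{\nu_k(h)\mid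 h\text{ a height function on }H^5\}=\{a\,\nu_k(h_1)\mid a\in\mathbb Z,\ -8\le a\le 8\}.$$ The point $\nu_k(h_1)$ has infinite order, so the coefficient $a$ is uniquely determined by $\nu_k(h)$. If $h$ and $h'$ differ by lowering or raising a single vertex, then $\nu_k(h)=a\,\nu_k(h_1)$ and $\nu_k(h')=a'\,\nu_k(h_1)$ with integers $a,a'$ such that $|a-a'|=1$. -/

import Mathlib

namespace Adinkra

/-! ### The hypercube `H⁵` and its height functions

Colours are indexed by `Fin 5`: the index `j` stands for colour `j + 1` of the rainbow
`(1, 2, 3, 4, 5)`, and addition in `Fin 5` is the cyclic order of the rainbow. -/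

/-- The vertices of `H⁵`, that is `{0,1}⁵` (`true` is `1`). -/
abbrev Vertex : Type := Fin 5 → Bool

/-- The neighbour of `v` along the edge of colour `j`: the `j`-th coordinate is changed. -/
def flipAt (v : Vertex) (j : Fin 5) : Vertex := Function.update v j (!(v j))

/-- White vertices have an odd number of entries `1`, black vertices an even number; so
`(1,1,1,1,1)` is white and `(0,0,0,0,0)` is black. -/
def IsWhite (v : Vertex) : Prop := Odd (Finset.univ.filter fun i => v i = true).card

/-- A height function on `H⁵`: adjacent vertices have heights that differ by exactly one. -/
structure Height where
  toFun : Vertex → ℕ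
  step : ∀ v j, |(toFun (flipAt v j) : ℤ) - (toFun v : ℤ)| = 1

instance : CoeFun Height (fun _ => Vertex → ℕ) := ⟨Height.toFun⟩

/-- `h'` is obtained from `h` by lowering the single vertex `v` (and `h` from `h'` by raising
`v`). -/
def Lowers (v : Vertex) (h h' : Height) : Prop :=
  h v = h' v + 2 ∧ ∀ w, w ≠ v → h' w = h w

/-- `max {|h v - h w| : v, w}`. -/
def spread (h : Height) : ℕ :=
  Finset.univ.sup fun p : Vertex × Vertex => ((h p.1 : ℤ) - (h p.2 : ℤ)).natAbs

/-- A height function is fully extended if its spread is maximal among all height functions. -/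
def IsFullyExtended (h : Height) : Prop := ∀ g : Height, spread g ≤ spread h

/-- `t` is a top vertex of `h`. -/
def IsTopVertex (h : Height) (t : Vertex) : Prop := ∀ v, h v ≤ h t

/-! ### Faces and discrete Morse divisors -/

/-- The faces of the surface are the 4-cycles of `H⁵` with two consecutive colours `j, j + 1`.
Each such cycle is given by `j` and by its unique vertex whose coordinates `j` and `j + 1`
are `0`. -/
abbrev Face : Type := {f : Fin 5 × Vertex // f.2 f.1 = false ∧ f.2 (f.1 + 1) = false}

/-- The four vertices of a face, in cyclic order around the face. -/
def corner (f : Face) : Fin 4 → Vertex :=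
  ![f.1.2, flipAt f.1.2 f.1.1, flipAt (flipAt f.1.2 f.1.1) (f.1.1 + 1), flipAt f.1.2 (f.1.1 + 1)]

/-- A face is a bow tie if exactly two heights occur on it (otherwise three heights occur, and
it is a diamond). -/
def IsBowTie (h : Height) (f : Face) : Prop :=
  (Finset.univ.image fun i => h (corner f i)).card = 2

/-- The number of sign changes of `u i - c` as `i` runs once around the cycle `Fin n`. -/
def signChanges {n : ℕ} [NeZero n] (u : Fin n → ℚ) (c : ℚ) : ℕ :=
  (Finset.univ.filter fun i : Fin n =>
    SignType.sign (u i - c) ≠ SignType.sign (u (i + 1) - c)).card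

/-- The coefficient of a mesh vertex of value `c` whose neighbours have, in cyclic order, the
values `u`: it is `-1` at a local extremum (no sign change), `0` at a regular point (two sign
changes), and `μ` at a saddle point with `2 + 2 μ` sign changes. -/
def morseCoeff {n : ℕ} [NeZero n] (u : Fin n → ℚ) (c : ℚ) : ℤ :=
  (signChanges u c : ℤ) / 2 - 1

/-- The coefficient of a vertex of `H⁵`; its neighbours are taken in rainbow order. -/
def vertexCoeff (h : Height) (v : Vertex) : ℤ :=
  morseCoeff (fun j : Fin 5 => (h (flipAt v j) : ℚ)) (h v : ℚ)

/-- The coefficient of a face centre. The centre of a bow tie is a vertex of the triangular mesh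
that is adjacent to the four corners and whose height is the average of theirs; a diamond is
triangulated without a new vertex, so that its centre does not occur. -/
noncomputable def faceCoeff (h : Height) (f : Face) : ℤ :=
  open Classical in
  if IsBowTie h f then
    morseCoeff (fun i : Fin 4 => (h (corner f i) : ℚ)) ((∑ i, (h (corner f i) : ℚ)) / 4)
  else 0

/-! ### The curve -/

/-- The golden ratio as a complex number. -/
noncomputable def phi : ℂ := (Real.goldenRatio : ℂ)

/-- `ζ = exp (2πi/10)`. -/
noncomputable def zeta : ℂ := Complex.exp (2 * Real.pi * Complex.I / 10)

/-- The equations of the curve, for homogeneous coordinates `[x 0 : x 1 : x 2 : x 3 : x 4]`. -/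
def OnCurve (x : Fin 5 → ℂ) : Prop :=
  x 0 ^ 2 + x 1 ^ 2 + x 2 ^ 2 = 0 ∧
  phi * x 0 ^ 2 + x 1 ^ 2 + x 3 ^ 2 = 0 ∧
  (1 + phi) * x 0 ^ 2 + x 1 ^ 2 + x 4 ^ 2 = 0

/-- The generalized Fermat curve in four-dimensional complex projective space. -/
abbrev Curve : Type := {p : Projectivization ℂ (Fin 5 → ℂ) // OnCurve p.rep}

/-- The numerator of the Möbius transformation
`η z = ((z - ζ) / (z - ζ⁻¹)) * ((ζ ^ 3 - ζ⁻¹) / (ζ - ζ ^ 3))` at the point `z = a / b` of the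
projective line (`b = 0` is the point at infinity). -/
noncomputable def etaNum (a b : ℂ) : ℂ := (a - zeta * b) * (zeta ^ 3 - zeta⁻¹)

/-- The denominator of `η` at `a / b`; see `etaNum`. -/
noncomputable def etaDen (a b : ℂ) : ℂ := (a - zeta⁻¹ * b) * (zeta - zeta ^ 3)

/-- The point `[x]` of the curve lies over the point `a / b` of the beach ball, that is
`π [x] = [(x 0) ^ 2 : (x 1) ^ 2]` is the point `x 1 ^ 2 / x 0 ^ 2 = η (a / b)` of the projective
line. -/
def LiesOver (x : Fin 5 → ℂ) (a b : ℂ) : Prop :=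
  x 1 ^ 2 * etaDen a b = x 0 ^ 2 * etaNum a b

/-- There is a path on the curve from `p` to `q` that lies over the segment of the ray
`{t * d : t ∈ [0, ∞]}` of the beach ball in which `t = s / (1 - s)` goes from `s = s₀` to
`s = s₁`. -/
def JoinedOver (d : ℂ) (s₀ s₁ : ℝ) (p q : Curve) : Prop :=
  ∃ (x : ℝ → Fin 5 → ℂ) (hx : ∀ s, x s ≠ 0),
    ContinuousOn x (Set.uIcc s₀ s₁) ∧
    (∀ s ∈ Set.uIcc s₀ s₁, OnCurve (x s) ∧ LiesOver (x s) (s * d) ((1 - s : ℝ) : ℂ)) ∧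
    Projectivization.mk ℂ (x s₀) (hx s₀) = p.1 ∧ Projectivization.mk ℂ (x s₁) (hx s₁) = q.1

/-- An embedding of `H⁵` into the curve that is compatible with the rainbow. Over the beach ball,
black vertices lie over `0`, white vertices over `∞`, and the edges of colour `j` are the connected
components of the preimage of the ray through `ζ ^ (2 j)`. A face with colours `j, j + 1` is a
connected component of the preimage of the sector between the rays of its two colours; its centre
lies over `ζ ^ (2 j + 1)`, and is joined to each of the four corners of the face within the face
over the ray through `ζ ^ (2 j + 1)`. (The index `j : Fin 5` is colour `j + 1`.) -/
structure Embedding where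
  vertex : Vertex → Curve
  center : Face → Curve
  edge : ∀ (v : Vertex) (j : Fin 5), ¬ IsWhite v →
    JoinedOver (zeta ^ (2 * (j : ℕ) + 2)) 0 1 (vertex v) (vertex (flipAt v j))
  center_black : ∀ (f : Face) (i : Fin 4), ¬ IsWhite (corner f i) →
    JoinedOver (zeta ^ (2 * (f.1.1 : ℕ) + 3)) 0 (1 / 2) (vertex (corner f i)) (center f)
  center_white : ∀ (f : Face) (i : Fin 4), IsWhite (corner f i) →
    JoinedOver (zeta ^ (2 * (f.1.1 : ℕ) + 3)) 1 (1 / 2) (vertex (corner f i)) (center f)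

/-- The discrete Morse divisor of `h` as a divisor on the curve. -/
noncomputable def morseDivisor (ε : Embedding) (h : Height) : Curve →₀ ℤ :=
  ∑ v, Finsupp.single (ε.vertex v) (vertexCoeff h v) +
    ∑ f, Finsupp.single (ε.center f) (faceCoeff h f)

/-! ### The elliptic curves and the maps to them -/

/-- `E k` is the curve `y ^ 2 = x * (x - 1) * (x - r k)`. The index `k : Fin 5` stands for
`E_{k+1}`. -/
noncomputable def r : Fin 5 → ℂ := ![phi + 1, phi, -phi, phi + 1, phi]

/-- `y ^ 2 = x ^ 3 - (1 + r k) * x ^ 2 + r k * x`. -/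
noncomputable def E (k : Fin 5) : WeierstrassCurve.Affine ℂ :=
  { a₁ := 0, a₂ := -(1 + r k), a₃ := 0, a₄ := r k, a₆ := 0 }

/-- The first coordinate of the map to `E k`. -/
noncomputable def nuX (k : Fin 5) (x : Fin 5 → ℂ) : ℂ :=
  ![-(2 * phi + 1) * (x 0 ^ 2 / x 4 ^ 2) - phi,
    x 1 ^ 2 / x 0 ^ 2 + phi + 1,
    (2 * phi + 1) * (x 2 ^ 2 / x 1 ^ 2) + phi + 1,
    (phi + 1) * (x 3 ^ 2 / x 2 ^ 2) - phi,
    -(x 4 ^ 2 / x 3 ^ 2) + phi + 1] k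

/-- The second coordinate of the map to `E k`. -/
noncomputable def nuY (k : Fin 5) (x : Fin 5 → ℂ) : ℂ :=
  ![(2 * phi + 1) * (x 1 * x 2 * x 3 / x 4 ^ 3),
    Complex.I * (x 2 * x 3 * x 4 / x 0 ^ 3),
    Complex.I * (2 * phi + 1) * (x 0 * x 3 * x 4 / x 1 ^ 3),
    Complex.I * phi * (x 0 * x 1 * x 4 / x 2 ^ 3),
    Complex.I * (x 0 * x 1 * x 2 / x 3 ^ 3)] k

theorem phi_sq : phi ^ 2 = phi + 1 := by
  unfold phi
  exact_mod_cast Real.goldenRatio_sq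

theorem phi_ne_zero : phi ≠ 0 := by
  intro h
  have := phi_sq
  simp [h] at this

theorem E_disc_ne_zero (k : Fin 5) : (E k).Δ ≠ 0 := by
  have h2 := phi_sq
  have h0 := phi_ne_zero
  have h1 : phi + 1 ≠ 0 := h2 ▸ pow_ne_zero 2 h0
  have h3 : phi - 1 ≠ 0 := fun h => by
    have : phi * (phi - 1) = 1 := by linear_combination h2
    simp [h] at this
  have h4 : (E k).Δ = 16 * (r k) ^ 2 * (r k - 1) ^ 2 := by
    simp only [E, WeierstrassCurve.Δ, WeierstrassCurve.b₂, WeierstrassCurve.b₄,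
      WeierstrassCurve.b₆, WeierstrassCurve.b₈]
    ring
  rw [h4]
  have h5 : r k ≠ 0 ∧ r k - 1 ≠ 0 := by
    fin_cases k
    · exact ⟨h1, by simpa [r] using h0⟩
    · exact ⟨h0, h3⟩
    · refine ⟨neg_ne_zero.mpr h0, fun h => h1 ?_⟩
      have h : -phi - 1 = 0 := h
      linear_combination -h
    · exact ⟨h1, by simpa [r] using h0⟩
    · exact ⟨h0, h3⟩
  have h16 : (16 : ℂ) ≠ 0 := by norm_num
  exact mul_ne_zero (mul_ne_zero h16 (pow_ne_zero 2 h5.1)) (pow_ne_zero 2 h5.2)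

theorem equation_aux (k : Fin 5) (X Y u v t w p₁ p₂ p₃ m : ℂ) (hw : w ≠ 0)
    (h₁ : X * w ^ 2 = p₁ * u ^ 2) (h₂ : (X - 1) * w ^ 2 = p₂ * v ^ 2)
    (h₃ : (X - r k) * w ^ 2 = p₃ * t ^ 2) (hY : Y * w ^ 3 = m * (u * v * t))
    (hm : m ^ 2 = p₁ * p₂ * p₃) : (E k).Equation X Y := by
  rw [WeierstrassCurve.Affine.equation_iff]
  simp only [E]
  have h6 : w ^ 6 ≠ 0 := pow_ne_zero 6 hw
  apply mul_right_cancel₀ h6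
  have hYY : Y ^ 2 * w ^ 6 = m ^ 2 * (u * v * t) ^ 2 := by
    linear_combination (Y * w ^ 3 + m * (u * v * t)) * hY
  have hX : X * (X - 1) * (X - r k) * w ^ 6 = p₁ * p₂ * p₃ * (u * v * t) ^ 2 := by
    calc X * (X - 1) * (X - r k) * w ^ 6
        = (X * w ^ 2) * ((X - 1) * w ^ 2) * ((X - r k) * w ^ 2) := by ring
      _ = _ := by rw [h₁, h₂, h₃]; ring
  linear_combination hYY - hX + (u * v * t) ^ 2 * hm

theorem nu_equation (k : Fin 5) (x : Fin 5 → ℂ) (hx : OnCurve x) (hk : x (k - 1) ≠ 0) :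
    (E k).Equation (nuX k x) (nuY k x) := by
  obtain ⟨e1, e2, e3⟩ := hx
  have h2 := phi_sq
  have hI := Complex.I_sq
  fin_cases k
  · have hk : x 4 ≠ 0 := hk
    have hX : nuX 0 x * x 4 ^ 2 = -(2 * phi + 1) * x 0 ^ 2 - phi * x 4 ^ 2 := by
      simp only [nuX, Matrix.cons_val]; field_simp
    have hY : nuY 0 x * x 4 ^ 3 = (2 * phi + 1) * (x 1 * x 2 * x 3) := by
      simp only [nuY, Matrix.cons_val]; field_simp
    refine equation_aux 0 (nuX 0 x) (nuY 0 x) (x 1) (x 2) (x 3) (x 4) phi (-(1 + phi)) (-(2 * phi + 1)) _ hk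
      ?_ ?_ ?_ hY ?_
    · linear_combination hX - phi * e3 + x 0 ^ 2 * h2
    · linear_combination hX - (phi + 1) * e3 + (1 + phi) * e1 + x 0 ^ 2 * h2
    · simp only [r, Matrix.cons_val]
      linear_combination hX - (2 * phi + 1) * e3 + (2 * phi + 1) * e2
    · linear_combination (-2 * phi - 1) * h2
  · have hk : x 0 ≠ 0 := hk
    have hX : nuX 1 x * x 0 ^ 2 = x 1 ^ 2 + (phi + 1) * x 0 ^ 2 := by
      simp only [nuX, Matrix.cons_val]; field_simp; ring
    have hY : nuY 1 x * x 0 ^ 3 = Complex.I * (x 4 * x 3 * x 2) := by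
      simp only [nuY, Matrix.cons_val]; field_simp
    refine equation_aux 1 (nuX 1 x) (nuY 1 x) (x 4) (x 3) (x 2) (x 0) (-1) (-1) (-1) _ hk ?_ ?_ ?_ hY ?_
    · linear_combination hX + e3
    · linear_combination hX + e2
    · simp only [r, Matrix.cons_val]
      linear_combination hX + e1
    · linear_combination hI
  · have hk : x 1 ≠ 0 := hk
    have hX : nuX 2 x * x 1 ^ 2 = (2 * phi + 1) * x 2 ^ 2 + (phi + 1) * x 1 ^ 2 := by
      simp only [nuX, Matrix.cons_val]; field_simp; ring
    have hY : nuY 2 x * x 1 ^ 3 = Complex.I * (2 * phi + 1) * (x 4 * x 3 * x 0) := by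
      simp only [nuY, Matrix.cons_val]; field_simp
    refine equation_aux 2 (nuX 2 x) (nuY 2 x) (x 4) (x 3) (x 0) (x 1) phi (phi + 1) (-(2 * phi + 1)) _ hk
      ?_ ?_ ?_ hY ?_
    · linear_combination hX + (2 * phi + 1) * e1 - phi * e3 + x 0 ^ 2 * h2
    · linear_combination hX + (2 * phi + 1) * e1 - (phi + 1) * e2 + x 0 ^ 2 * h2
    · simp only [r, Matrix.cons_val]
      linear_combination hX + (2 * phi + 1) * e1
    · linear_combination (2 * phi + 1) ^ 2 * hI + (2 * phi + 1) * h2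
  · have hk : x 2 ≠ 0 := hk
    have hX : nuX 3 x * x 2 ^ 2 = (phi + 1) * x 3 ^ 2 - phi * x 2 ^ 2 := by
      simp only [nuX, Matrix.cons_val]; field_simp
    have hY : nuY 3 x * x 2 ^ 3 = Complex.I * phi * (x 4 * x 0 * x 1) := by
      simp only [nuY, Matrix.cons_val]; field_simp
    refine equation_aux 3 (nuX 3 x) (nuY 3 x) (x 4) (x 0) (x 1) (x 2) 1 (-phi) phi _ hk ?_ ?_ ?_ hY ?_
    · linear_combination hX + (phi + 1) * e2 - phi * e1 - e3 - x 0 ^ 2 * h2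
    · linear_combination hX + (phi + 1) * e2 - (phi + 1) * e1 - x 0 ^ 2 * h2
    · simp only [r, Matrix.cons_val]
      linear_combination hX + (phi + 1) * e2 - (2 * phi + 1) * e1 - x 0 ^ 2 * h2
    · linear_combination phi ^ 2 * hI
  · have hk : x 3 ≠ 0 := hk
    have hX : nuX 4 x * x 3 ^ 2 = -x 4 ^ 2 + (phi + 1) * x 3 ^ 2 := by
      simp only [nuX, Matrix.cons_val]; field_simp; ring
    have hY : nuY 4 x * x 3 ^ 3 = Complex.I * (x 2 * x 1 * x 0) := by
      simp only [nuY, Matrix.cons_val]; field_simp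
    refine equation_aux 4 (nuX 4 x) (nuY 4 x) (x 2) (x 1) (x 0) (x 3) phi (1 - phi) 1 _ hk ?_ ?_ ?_ hY ?_
    · linear_combination hX - e3 + (phi + 1) * e2 - phi * e1 - x 0 ^ 2 * h2
    · linear_combination hX - e3 + phi * e2 - x 0 ^ 2 * h2
    · simp only [r, Matrix.cons_val]
      linear_combination hX - e3 + e2
    · linear_combination hI + h2

theorem nu_nonsingular (k : Fin 5) (x : Fin 5 → ℂ) (hx : OnCurve x) (hk : x (k - 1) ≠ 0) :
    (E k).Nonsingular (nuX k x) (nuY k x) :=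
  (WeierstrassCurve.Affine.equation_iff_nonsingular_of_Δ_ne_zero (E_disc_ne_zero k)).mp
    (nu_equation k x hx hk)

/-- The map `ν_k` from the curve to `E k`. The coordinates are homogeneous of degree zero, and
the points with `x (k - 1) = 0`, where they have poles, go to the point at infinity. -/
noncomputable def nu (k : Fin 5) (p : Curve) : (E k).Point :=
  open Classical in
  if hk : p.1.rep (k - 1) = 0 then 0
  else .some _ _ (nu_nonsingular k p.1.rep p.2 hk)

/-- The value of `ν_k` can be computed from any homogeneous coordinates of the point. -/
theorem nu_eq (k : Fin 5) (p : Curve) (x : Fin 5 → ℂ) (hx0 : x ≠ 0) (hx : OnCurve x)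
    (hp : Projectivization.mk ℂ x hx0 = p.1) :
    nu k p = open Classical in
      if hk : x (k - 1) = 0 then 0 else .some _ _ (nu_nonsingular k x hx hk) := by
  obtain ⟨p, hpc⟩ := p
  subst hp
  obtain ⟨a, ha⟩ := Projectivization.exists_smul_eq_mk_rep ℂ x hx0
  have ha0 : (a : ℂ) ≠ 0 := a.ne_zero
  have hrep : (Projectivization.mk ℂ x hx0).rep = fun i => (a : ℂ) * x i := by
    rw [← ha]; rfl
  have key : ∀ u v w z : ℂ, (a * u) * (a * v) * (a * w) / (a * z) ^ 3 = u * v * w / z ^ 3 := by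
    intro u v w z
    rw [mul_pow, show (a : ℂ) * u * (a * v) * (a * w) = (a : ℂ) ^ 3 * (u * v * w) by ring,
      mul_div_mul_left _ _ (pow_ne_zero 3 ha0)]
  unfold nu
  by_cases hk : x (k - 1) = 0
  · rw [dif_pos hk, dif_pos (by rw [hrep]; simp [hk])]
  · rw [dif_neg hk, dif_neg (by rw [hrep]; exact mul_ne_zero ha0 hk)]
    rw [WeierstrassCurve.Affine.Point.some.injEq]
    simp only [hrep]
    fin_cases k <;> simp only [nuX, nuY, Matrix.cons_val, Fin.zero_eta, Fin.mk_one, Fin.reduceFinMk]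
    all_goals
      constructor
      · simp only [mul_pow, mul_div_mul_left _ _ (pow_ne_zero 2 ha0)]
      · simp only [key]

/-- The image in `E_1 × ⋯ × E_5` of the divisor of a height function; its `k`-th component is
`ν_k(h)`. -/
noncomputable def nuHeight (ε : Embedding) (h : Height) (k : Fin 5) : (E k).Point :=
  (morseDivisor ε h).sum fun p n => n • nu k p

end Adinkra

namespace Adinkra

/-! In the beach-ball coordinate every `x i ^ 2` is, up to a common factor, a linear form vanishing
at an odd power of `ζ` (`exists_sq_eq`). Paths over rays are therefore square roots of linear forms,
and they are determined by their initial point (`path_unique`). So an embedding is determined by the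
coordinates of `(0,0,0,0,0)`: all other vertices differ from it by signs and one fixed twist for
white vertices (`Embedding.exists_coord`).

Put `J = k + 3`. Up to the sign `faceSign J`, the map `nu k` sends all black vertices to one point
`B`, all white ones to one point `W`, and all centres of faces with colours `J, J + 1` to one point
`C`. The other centres go to points of order at most two that depend only on the colours of the
face. Since `B + W = 2 C`, a vertex `v` goes to `faceSign J v • (C + parity v • G)` with `G = B -
C`. In the image of the divisor of `h` the multiples of `C` cancel
(`sum_vertexCoeff_add_sum_faceCoeff`). The torsion cancels too, because the number of bow ties has
the same parity for all five kinds of faces (`sum_bowTies_smul_torsionPoint`). What remains is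
`amplitude J h • G` (`nuHeight_eq_smul`).

The amplitude is a signed count of the diamonds among the eight faces with colours `J, J + 1`, so it
lies between `-8` and `8`. Lowering a vertex exchanges diamond and bow tie on exactly one of these
faces and so changes the amplitude by one. A reflection symmetry shows that it vanishes for fully
extended height functions; hence `h₁` goes to `G` or `-G`. Flattening diamonds one at a time,
together with reflection, produces all values.

The point `G` has infinite order by a 2-adic argument: in a coordinate `X` for which `E k` is a
twist of `y ^ 2 = X (X ^ 2 + √5 X + 1)`, the point `2 B` has `X = -√5 / 4`, and each further
doubling multiplies the power of `4` in the denominator by exactly `4`. -/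

/-! ### The tenth root of unity and the golden ratio -/

theorem zeta_ne_zero : zeta ≠ 0 := Complex.exp_ne_zero _

theorem zeta_eq : zeta = Complex.exp ((Real.pi / 5 : ℝ) * Complex.I) := by
  unfold zeta; congr 1; push_cast; ring

theorem zeta_pow_five : zeta ^ 5 = -1 := by
  rw [zeta_eq, ← Complex.exp_nat_mul, ← Complex.exp_pi_mul_I]
  congr 1; push_cast; ring

theorem zeta_inv : zeta⁻¹ = -zeta ^ 4 := by
  rw [inv_eq_iff_eq_inv, eq_comm]
  apply inv_eq_of_mul_eq_one_left
  linear_combination -zeta_pow_five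

theorem phi_eq : phi = zeta - zeta ^ 4 := by
  have h : phi = zeta + zeta⁻¹ := by
    rw [zeta_eq, ← Complex.exp_neg, ← neg_mul, ← Complex.two_cos, ← Complex.ofReal_cos,
      Real.cos_pi_div_five]
    simp only [phi, Real.goldenRatio]
    push_cast; ring
  rw [h, zeta_inv]; ring

/-- Substituting `φ = ζ + ζ⁻¹` in `φ ^ 2 = φ + 1` gives the tenth cyclotomic polynomial. Unlike `ζ ^
5 = -1`, this relation excludes `ζ = -1`. -/
theorem zeta_cyclotomic : zeta ^ 4 = zeta ^ 3 - zeta ^ 2 + zeta - 1 := by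
  have h := phi_sq
  rw [phi_eq] at h
  have h5 := zeta_pow_five
  grind

theorem phi_eq' : phi = -zeta ^ 3 + zeta ^ 2 + 1 := by
  rw [phi_eq, zeta_cyclotomic]; ring

theorem zeta_re_pos : 0 < zeta.re := by
  rw [zeta_eq, Complex.exp_ofReal_mul_I_re]
  exact Real.cos_pos_of_mem_Ioo ⟨by linarith [Real.pi_pos], by linarith [Real.pi_pos]⟩

theorem zeta_sq_re_pos : 0 < (zeta ^ 2).re := by
  rw [zeta_eq, ← Complex.exp_nat_mul, show ((2 : ℕ) : ℂ) * ((Real.pi / 5 : ℝ) * Complex.I) =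
    ((2 * Real.pi / 5 : ℝ) : ℂ) * Complex.I by push_cast; ring, Complex.exp_ofReal_mul_I_re]
  exact Real.cos_pos_of_mem_Ioo ⟨by linarith [Real.pi_pos], by linarith [Real.pi_pos]⟩

theorem star_zeta : (starRingEnd ℂ) zeta = -zeta ^ 4 := by
  rw [← zeta_inv, zeta_eq, ← Complex.exp_conj, ← Complex.exp_neg, map_mul, Complex.conj_ofReal, Complex.conj_I, mul_neg]

/-! ### A common normal form of the elliptic curves -/

open WeierstrassCurve.Affine

/-- The scale of the affine coordinate `X` with `x = lam k * X + off k`, in which `E k` becomes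
`y ^ 2 = lam k ^ 3 * X * (X ^ 2 + √5 X + 1)`. -/
noncomputable def lam : Fin 5 → ℂ := ![-phi, 1, phi, -phi, 1]

/-- The offset of the affine coordinate `X`; see `lam`. -/
noncomputable def off : Fin 5 → ℂ := ![0, phi, 1, 0, phi]

theorem lam_ne_zero (k : Fin 5) : lam k ≠ 0 := by
  have := phi_ne_zero
  fin_cases k <;> simp [lam, this]

/-- This identity and the next two compare the coefficients of `X ^ 2`, `X` and `1` after the
substitution `x = lam k * X + off k`; here `2 φ - 1 = √5`. -/
theorem one_add_r (k : Fin 5) : 1 + r k = 3 * off k - lam k * (2 * phi - 1) := by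
  have := phi_sq
  fin_cases k <;> simp only [lam, off, r, Fin.zero_eta, Fin.mk_one, Fin.reduceFinMk,
    Matrix.cons_val] <;> grind

theorem r_eq (k : Fin 5) : r k = lam k ^ 2 - 3 * off k ^ 2 + 2 * (1 + r k) * off k := by
  have := phi_sq
  fin_cases k <;> simp only [lam, off, r, Fin.zero_eta, Fin.mk_one, Fin.reduceFinMk,
    Matrix.cons_val] <;> grind

theorem off_root (k : Fin 5) : off k ^ 3 - (1 + r k) * off k ^ 2 + r k * off k = 0 := by
  have := phi_sq
  fin_cases k <;> simp only [off, r, Fin.zero_eta, Fin.mk_one, Fin.reduceFinMk,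
    Matrix.cons_val] <;> grind

theorem equation_scaled {k : Fin 5} {X y : ℂ} :
    (E k).Equation (lam k * X + off k) y ↔
      y ^ 2 = lam k ^ 3 * (X * (X ^ 2 + (2 * phi - 1) * X + 1)) := by
  rw [WeierstrassCurve.Affine.equation_iff]
  simp only [E]
  have h1 := one_add_r k
  have h2 := r_eq k
  have h3 := off_root k
  constructor <;> intro h
  · linear_combination h - lam k ^ 2 * X ^ 2 * h1 + lam k * X * h2 + h3
  · linear_combination h + lam k ^ 2 * X ^ 2 * h1 - lam k * X * h2 - h3

theorem nonsingular_scaled {k : Fin 5} {X y : ℂ}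
    (h : y ^ 2 = lam k ^ 3 * (X * (X ^ 2 + (2 * phi - 1) * X + 1))) :
    (E k).Nonsingular (lam k * X + off k) y :=
  (equation_iff_nonsingular_of_Δ_ne_zero (E_disc_ne_zero k)).mp (equation_scaled.mpr h)

/-! ### Explicit addition and duplication -/

theorem some_congr {k : Fin 5} {x x' y y' : ℂ} {h : (E k).Nonsingular x y}
    (hx : x = x') (hy : y = y') :
    Point.some x y h = Point.some x' y' (hx ▸ hy ▸ h) := by
  subst hx hy; rfl

theorem negY_eq (k : Fin 5) (x y : ℂ) : (E k).negY x y = -y := by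
  simp [negY, E]

/-- The chord construction, with the slope `l` characterised by a product, so that an application
needs only polynomial identities. -/
theorem add_some_of_X_ne {k : Fin 5} {x₁ y₁ x₂ y₂ x₃ y₃ l : ℂ} (h₁ : (E k).Nonsingular x₁ y₁)
    (h₂ : (E k).Nonsingular x₂ y₂) (h₃ : (E k).Nonsingular x₃ y₃) (hx : x₁ ≠ x₂)
    (hl : y₁ - y₂ = l * (x₁ - x₂)) (hx₃ : x₃ = l ^ 2 + (1 + r k) - x₁ - x₂)
    (hy₃ : y₃ = -(y₁ + l * (x₃ - x₁))) :
    Point.some x₁ y₁ h₁ + Point.some x₂ y₂ h₂ = Point.some x₃ y₃ h₃ := by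
  have hs : (E k).slope x₁ x₂ y₁ y₂ = l := by
    rw [slope_of_X_ne hx, hl, mul_div_cancel_right₀ _ (sub_ne_zero.mpr hx)]
  rw [Point.add_of_X_ne hx]
  have hX : (E k).addX x₁ x₂ l = x₃ := by rw [hx₃]; simp [addX, E]; ring
  apply some_congr
  · rw [hs, hX]
  · rw [hs]
    simp only [addY, negAddY, hX, negY_eq]
    rw [hy₃]; ring

theorem exists_add_self {k : Fin 5} {x₁ y₁ x₃ l : ℂ} (h₁ : (E k).Nonsingular x₁ y₁) (hy : y₁ ≠ 0)
    (hl : 3 * x₁ ^ 2 - 2 * (1 + r k) * x₁ + r k = l * (2 * y₁))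
    (hx₃ : x₃ = l ^ 2 + (1 + r k) - x₁ - x₁) :
    ∃ h₃ : (E k).Nonsingular x₃ (-(y₁ + l * (x₃ - x₁))),
      Point.some x₁ y₁ h₁ + Point.some x₁ y₁ h₁ = Point.some _ _ h₃ := by
  have h2 : y₁ ≠ (E k).negY x₁ y₁ := by
    rw [negY_eq]
    intro h
    apply hy
    linear_combination h / 2
  have hs : (E k).slope x₁ x₁ y₁ y₁ = l := by
    rw [slope_of_Y_ne rfl h2, div_eq_iff (sub_ne_zero.mpr h2), negY_eq]
    simp only [E]
    linear_combination hl
  have hX : (E k).addX x₁ x₁ l = x₃ := by rw [hx₃]; simp [addX, E]; ring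
  have hX' : (E k).addX x₁ x₁ ((E k).slope x₁ x₁ y₁ y₁) = x₃ := by rw [hs, hX]
  have hY' : (E k).addY x₁ x₁ y₁ ((E k).slope x₁ x₁ y₁ y₁) = -(y₁ + l * (x₃ - x₁)) := by
    rw [hs]
    simp only [addY, negAddY, hX, negY_eq]
    ring
  exact ⟨_, (Point.add_self_of_Y_ne h2).trans (some_congr hX' hY')⟩

/-- The duplication formula in the coordinate `X`. -/
theorem exists_double {k : Fin 5} {X X' y : ℂ} (h : (E k).Nonsingular (lam k * X + off k) y)
    (hy : y ≠ 0) (hX : X' * (4 * (X * (X ^ 2 + (2 * phi - 1) * X + 1))) = (X ^ 2 - 1) ^ 2) :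
    ∃ (y' : ℂ) (h' : (E k).Nonsingular (lam k * X' + off k) y'),
      Point.some _ _ h + Point.some _ _ h = Point.some _ _ h' := by
  have he := equation_scaled.mp h.1
  have hl := lam_ne_zero k
  set F := X * (X ^ 2 + (2 * phi - 1) * X + 1) with hF
  have hF0 : F ≠ 0 := by
    intro h0; apply hy; rw [h0] at he; simpa using he
  -- The slope of the tangent: the right-hand side is the derivative of the cubic with respect to
  -- `x`.
  obtain ⟨l, hl'⟩ : ∃ l, l * (2 * y) = lam k ^ 2 * (3 * X ^ 2 + 2 * (2 * phi - 1) * X + 1) :=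
    ⟨_, div_mul_cancel₀ _ (by simpa using hy)⟩
  have h1 := one_add_r k
  have h2 := r_eq k
  have hxx : lam k * X' + off k = l ^ 2 + (1 + r k) - (lam k * X + off k) - (lam k * X + off k) := by
    have h4 : 4 * F * lam k ^ 3 ≠ 0 := by simp [hF0, hl]
    apply mul_right_cancel₀ h4
    have hll : l ^ 2 * (4 * F * lam k ^ 3) =
        (lam k ^ 2 * (3 * X ^ 2 + 2 * (2 * phi - 1) * X + 1)) ^ 2 := by
      rw [← hl']; linear_combination -4 * l ^ 2 * he
    linear_combination lam k ^ 4 * hX - hll - 4 * F * lam k ^ 3 * h1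
      + 4 * lam k ^ 4 * (2 * X + 2 * phi - 1) * hF
  have hsl : 3 * (lam k * X + off k) ^ 2 - 2 * (1 + r k) * (lam k * X + off k) + r k =
      l * (2 * y) := by
    linear_combination -hl' - 2 * lam k * X * h1 + h2
  obtain ⟨h₃, h₃'⟩ := exists_add_self h hy hsl hxx
  exact ⟨_, h₃, h₃'⟩

/-! ### A 2-adic criterion for infinite order -/

theorem five_eq : (2 * phi - 1) ^ 2 = 5 := by
  linear_combination 4 * phi_sq

theorem five_form_ne_zero {a b : ℤ} (ha : Odd a) (hb : Even b) : 5 * a ^ 2 + 5 * a * b + b ^ 2 ≠ 0 := by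
  intro h
  have : Odd (5 * a ^ 2 + 5 * a * b + b ^ 2) := by
    have : Odd (5 * a ^ 2) := (by decide : Odd (5 : ℤ)).mul ha.pow
    exact (this.add_even (hb.mul_left _)).add_even (hb.pow_of_ne_zero two_ne_zero)
  rw [h] at this
  exact absurd this (by decide)

/-- The points with `X = √5 a / (4 ^ n c)` for odd integers `a` and `c`. -/
def HasLevel (k : Fin 5) (n : ℕ) (P : (E k).Point) : Prop :=
  ∃ (a c : ℤ) (y : ℂ) (h : (E k).Nonsingular
      (lam k * ((2 * phi - 1) * a / ((4 : ℂ) ^ n * c)) + off k) y),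
    Odd a ∧ Odd c ∧ P = Point.some _ _ h

/-- For `X = √5 a / b` the duplication formula gives `√5 (5a² - b²)² / (4b · 5a (5a² + 5ab + b²))`.
If `a` is odd and `b` even, every factor other than `4b` is odd, so the denominator gains exactly
one factor `4`. The condition `n ≠ 0` makes `b = 4 ^ n c` even. -/
theorem HasLevel.double {k : Fin 5} {n : ℕ} {P : (E k).Point} (hn : n ≠ 0) (hP : HasLevel k n P) :
    HasLevel k (n + 1) (P + P) := by
  obtain ⟨a, c, y, h, ha, hc, rfl⟩ := hP
  set b : ℤ := 4 ^ n * c with hb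
  have hbe : Even b := ((by decide : Even (4 : ℤ)).pow_of_ne_zero hn).mul_right _
  have hc0 : c ≠ 0 := fun h => by simp [h] at hc
  have ha0 : a ≠ 0 := fun h => by simp [h] at ha
  have hb0 : b ≠ 0 := mul_ne_zero (by positivity) hc0
  have hq := five_form_ne_zero ha hbe
  have hbC : (4 : ℂ) ^ n * c = b := by rw [hb]; push_cast; rfl
  have hbc0 : (b : ℂ) ≠ 0 := by exact_mod_cast hb0
  have hac0 : (a : ℂ) ≠ 0 := by exact_mod_cast ha0
  have hqc : (5 * a ^ 2 + 5 * a * b + b ^ 2 : ℂ) ≠ 0 := by exact_mod_cast hq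
  have hw := five_eq
  have hw0 : 2 * phi - 1 ≠ 0 := fun h => by simp [h] at hw
  generalize hx : (4 : ℂ) ^ n * c = b' at h
  obtain rfl : b' = b := hx.symm.trans hbC
  have hF : ((2 * phi - 1) * a / b) * (((2 * phi - 1) * a / b) ^ 2 +
      (2 * phi - 1) * ((2 * phi - 1) * a / b) + 1) =
      (2 * phi - 1) * a * (5 * a ^ 2 + 5 * a * b + b ^ 2) / (b : ℂ) ^ 3 := by
    field_simp
    linear_combination (a ^ 2 + a * b : ℂ) * hw
  have hy : y ≠ 0 := by
    rintro rfl
    have := equation_scaled.mp h.1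
    rw [hF] at this
    have h2 : lam k ^ 3 * ((2 * phi - 1) * a * (5 * a ^ 2 + 5 * a * b + b ^ 2) / (b : ℂ) ^ 3) ≠ 0 :=
      mul_ne_zero (pow_ne_zero _ (lam_ne_zero k))
        (div_ne_zero (mul_ne_zero (mul_ne_zero hw0 hac0) hqc) (pow_ne_zero _ hbc0))
    exact h2 (by rw [← this]; ring)
  have hbb : (4 : ℂ) ^ (n + 1) * (c * (5 * a * (5 * a ^ 2 + 5 * a * b + b ^ 2)) : ℤ) =
      4 * b * (5 * a * (5 * a ^ 2 + 5 * a * b + b ^ 2)) := by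
    rw [← hbC]; push_cast; rw [← hbC]; ring
  obtain ⟨y', h', he⟩ := exists_double (X' := (2 * phi - 1) * ((5 * a ^ 2 - b ^ 2) ^ 2 : ℤ) /
    ((4 : ℂ) ^ (n + 1) * (c * (5 * a * (5 * a ^ 2 + 5 * a * b + b ^ 2)) : ℤ))) h hy (by
      rw [hF, hbb]
      push_cast
      have hsq : ((2 * phi - 1) * a / b) ^ 2 = (5 * a ^ 2 / b ^ 2 : ℂ) := by
        rw [div_pow, mul_pow, hw]
      rw [hsq]
      generalize (5 * a ^ 2 + 5 * a * b + b ^ 2 : ℂ) = q at hqc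
      field_simp
      linear_combination (5 * a ^ 2 - b ^ 2 : ℂ) ^ 2 * hw)
  refine ⟨(5 * a ^ 2 - b ^ 2) ^ 2, _, y', h', ?_, ?_, he⟩
  · refine Odd.pow (Odd.sub_even ?_ (hbe.pow_of_ne_zero two_ne_zero))
    exact (by decide : Odd (5 : ℤ)).mul ha.pow
  · refine hc.mul (((by decide : Odd (5 : ℤ)).mul ha).mul ?_)
    have : Odd (5 * a ^ 2) := (by decide : Odd (5 : ℤ)).mul ha.pow
    exact (this.add_even (hbe.mul_left _)).add_even (hbe.pow_of_ne_zero two_ne_zero)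

theorem le_of_four_pow_mul_eq {m n : ℕ} {c d : ℤ} (hd : Odd d)
    (h : 4 ^ m * c = 4 ^ n * d) : m ≤ n := by
  by_contra! hlt
  obtain ⟨i, rfl⟩ := Nat.exists_eq_add_of_lt hlt
  have h4 : (4 : ℤ) ^ n ≠ 0 := by positivity
  have : d = 4 * (4 ^ i * c) := by
    apply mul_left_cancel₀ h4
    rw [← h]; ring
  rw [this] at hd
  exact absurd hd (by rw [Int.not_odd_iff_even]; exact (by decide : Even (4 : ℤ)).mul_right _)

/-- Used in both directions, this shows that the level is determined by the point. -/
theorem HasLevel.le {k : Fin 5} {m n : ℕ} {P : (E k).Point} (hm : HasLevel k m P)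
    (hn : HasLevel k n P) : m ≤ n := by
  obtain ⟨a, c, y, h, ha, hc, rfl⟩ := hm
  obtain ⟨a', c', y', h', ha', hc', he⟩ := hn
  rw [Point.some.injEq] at he
  have hx := he.1
  have hw := five_eq
  have hw0 : 2 * phi - 1 ≠ 0 := fun h => by simp [h] at hw
  have hl := lam_ne_zero k
  have h0 : (c : ℂ) ≠ 0 := by
    rintro h; simp only [Int.cast_eq_zero] at h; simp [h] at hc
  have h0' : (c' : ℂ) ≠ 0 := by
    rintro h; simp only [Int.cast_eq_zero] at h; simp [h] at hc'
  have h1 : (4 : ℂ) ^ m * (c * a') = 4 ^ n * (c' * a) := by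
    have h2 := mul_left_cancel₀ hl (add_right_cancel hx)
    rw [div_eq_div_iff (mul_ne_zero (pow_ne_zero _ (by norm_num)) h0)
      (mul_ne_zero (pow_ne_zero _ (by norm_num)) h0')] at h2
    apply mul_left_cancel₀ hw0
    linear_combination -h2
  exact le_of_four_pow_mul_eq (hc'.mul ha) (by exact_mod_cast h1)

/-- The point `2 ^ n • P` has level `n + 1`, so these multiples are pairwise distinct. -/
theorem HasLevel.not_isOfFinAddOrder {k : Fin 5} {P : (E k).Point} (hP : HasLevel k 1 P) :
    ¬ IsOfFinAddOrder P := by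
  intro hfin
  have hlev : ∀ n : ℕ, HasLevel k (n + 1) ((2 ^ n : ℕ) • P) := by
    intro n
    induction n with
    | zero => simpa using hP
    | succ n ih =>
      rw [pow_succ, mul_comm, mul_smul, two_smul]
      exact ih.double n.succ_ne_zero
  have := hfin.finite_multiples.to_subtype
  obtain ⟨m, n, hmn, he⟩ := Finite.exists_ne_map_eq_of_infinite
    fun n : ℕ => (⟨(2 ^ n : ℕ) • P, 2 ^ n, rfl⟩ : AddSubmonoid.multiples P)
  have he : (2 ^ m : ℕ) • P = (2 ^ n : ℕ) • P := congrArg Subtype.val he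
  have h1 := hlev m
  have h2 := hlev n
  rw [he] at h1
  exact hmn (by have := h1.le h2; have := h2.le h1; omega)

/-! ### The images of vertices and centres, and the generator -/

theorem neg_some_eq {k : Fin 5} {x y : ℂ} (h : (E k).Nonsingular x y)
    (h' : (E k).Nonsingular x (-y)) : -Point.some x y h = Point.some x (-y) h' := by
  rw [Point.neg_some]
  exact some_congr rfl (negY_eq k x y)

theorem phi_cube : phi ^ 3 = 2 * phi + 1 := by
  linear_combination (phi + 1) * phi_sq

section Points

variable {k : Fin 5} {s : ℂ}

theorem nonsingular_black (hs : s ^ 2 = lam k ^ 3 * phi) :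
    (E k).Nonsingular (lam k * (-zeta ^ 2) + off k) (s * zeta ^ 2) := by
  apply nonsingular_scaled
  have h1 := phi_eq'
  have h2 := zeta_cyclotomic
  rw [mul_pow, hs]
  have h3 : phi * (zeta ^ 2) ^ 2 =
      -zeta ^ 2 * ((-zeta ^ 2) ^ 2 + (2 * phi - 1) * -zeta ^ 2 + 1) := by grind
  linear_combination lam k ^ 3 * h3

theorem nonsingular_white (hs : s ^ 2 = lam k ^ 3 * phi) :
    (E k).Nonsingular (lam k * zeta ^ 3 + off k) (-s * zeta ^ 3) := by
  apply nonsingular_scaled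
  have h1 := phi_eq'
  have h2 := zeta_cyclotomic
  rw [mul_pow, neg_sq, hs]
  have h3 : phi * (zeta ^ 3) ^ 2 =
      zeta ^ 3 * ((zeta ^ 3) ^ 2 + (2 * phi - 1) * zeta ^ 3 + 1) := by grind
  linear_combination lam k ^ 3 * h3

theorem nonsingular_center (hs : s ^ 2 = lam k ^ 3 * phi) :
    (E k).Nonsingular (lam k * 1 + off k) (-phi * s) := by
  apply nonsingular_scaled
  rw [mul_pow, neg_sq, hs]
  linear_combination lam k ^ 3 * phi_cube

theorem nonsingular_off (k : Fin 5) : (E k).Nonsingular (lam k * 0 + off k) 0 := by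
  apply nonsingular_scaled
  ring

/-- The image of a black vertex. -/
noncomputable def blackPoint (hs : s ^ 2 = lam k ^ 3 * phi) : (E k).Point :=
  .some _ _ (nonsingular_black hs)

/-- The image of a white vertex. -/
noncomputable def whitePoint (hs : s ^ 2 = lam k ^ 3 * phi) : (E k).Point :=
  .some _ _ (nonsingular_white hs)

/-- The image of a face centre at which `nu k` is not ramified over the projective line. -/
noncomputable def centerPoint (hs : s ^ 2 = lam k ^ 3 * phi) : (E k).Point :=
  .some _ _ (nonsingular_center hs)

/-- The point of order two with `X = 0`. -/
noncomputable def offPoint (k : Fin 5) : (E k).Point :=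
  .some _ _ (nonsingular_off k)

theorem neg_offPoint : -offPoint k = offPoint k := by
  rw [offPoint, neg_some_eq _ (by simpa using nonsingular_off k)]
  exact some_congr rfl neg_zero

/-- Translation by the point of order two with `X = 0` replaces `X` by `1 / X`. It exchanges the
values `-ζ ^ 2` and `ζ ^ 3`, so it carries the black point to minus the white one. -/
theorem blackPoint_add_whitePoint (hs : s ^ 2 = lam k ^ 3 * phi) :
    blackPoint hs + whitePoint hs = offPoint k := by
  have hl := lam_ne_zero k
  have hns : (E k).Nonsingular (lam k * zeta ^ 3 + off k) (s * zeta ^ 3) := by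
    simpa using nonsingular_white (s := -s) (by rw [neg_sq, hs])
  have h : blackPoint hs + offPoint k = -whitePoint hs := by
    rw [whitePoint, neg_some_eq _ (by simpa using hns)]
    -- The line joins a point to the one with `X = 0` and `y = 0`, so its slope is `y / (lam k *
    -- X)`.
    refine add_some_of_X_ne (l := -s / lam k) _ _ _ ?_ ?_ ?_ ?_
    · simp [hl, zeta_ne_zero]
    · field_simp; ring
    · rw [one_add_r, div_pow, neg_sq, hs]
      have : lam k ^ 3 * phi / lam k ^ 2 = lam k * phi := by field_simp
      rw [this]
      have h1 := phi_eq'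
      have h2 := zeta_cyclotomic
      linear_combination lam k * h1
    · field_simp; ring
  rw [eq_neg_iff_add_eq_zero, add_right_comm, ← eq_neg_iff_add_eq_zero, neg_offPoint] at h
  exact h

/-- The value `X = 1` is fixed by `X ↦ 1 / X`, so translation by the point with `X = 0` negates this
point. -/
theorem centerPoint_add_self (hs : s ^ 2 = lam k ^ 3 * phi) :
    centerPoint hs + centerPoint hs = offPoint k := by
  have hl := lam_ne_zero k
  have h : centerPoint hs + offPoint k = -centerPoint hs := by
    rw [centerPoint, neg_some_eq _ (by
      simpa using nonsingular_center (s := -s) (by rw [neg_sq, hs]))]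
    refine add_some_of_X_ne (l := -phi * s / lam k) _ _ _ ?_ ?_ ?_ ?_
    · simp [hl]
    · field_simp; ring
    · rw [one_add_r, div_pow, mul_pow, neg_sq, hs]
      have : phi ^ 2 * (lam k ^ 3 * phi) / lam k ^ 2 = lam k * phi ^ 3 := by field_simp
      rw [this]
      linear_combination -lam k * phi_cube
    · ring
  rw [eq_neg_iff_add_eq_zero, add_right_comm, ← eq_neg_iff_add_eq_zero, neg_offPoint] at h
  exact h

/-- The generator of the group that contains the images of the height functions. -/
noncomputable def generator (hs : s ^ 2 = lam k ^ 3 * phi) : (E k).Point :=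
  blackPoint hs - centerPoint hs

theorem whitePoint_sub_centerPoint (hs : s ^ 2 = lam k ^ 3 * phi) :
    whitePoint hs - centerPoint hs = -generator hs := by
  have h : blackPoint hs + whitePoint hs = centerPoint hs + centerPoint hs :=
    (blackPoint_add_whitePoint hs).trans (centerPoint_add_self hs).symm
  rw [generator, neg_sub, sub_eq_sub_iff_add_eq_add, add_comm, h]

theorem generator_not_isOfFinAddOrder (hs : s ^ 2 = lam k ^ 3 * phi) :
    ¬ IsOfFinAddOrder (generator hs) := by
  have hl := lam_ne_zero k
  have hphi := phi_ne_zero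
  have hs0 : s ≠ 0 := by
    rintro rfl
    exact mul_ne_zero (pow_ne_zero 3 hl) hphi (by rw [← hs]; ring)
  have hlev : HasLevel k 1 (blackPoint hs + blackPoint hs) := by
    -- The double of the black point has `X = -√5 / 4`, which is level one with `a = -1` and `c =
    -- 1`.
    obtain ⟨y, h, he⟩ := exists_double (X' := (2 * phi - 1) * (-1 : ℤ) / ((4 : ℂ) ^ 1 * (1 : ℤ)))
      (nonsingular_black hs) (mul_ne_zero hs0 (pow_ne_zero 2 zeta_ne_zero)) (by
        have h1 := phi_eq'
        have h2 := zeta_cyclotomic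
        push_cast
        rw [h1]
        ring_nf
        grind)
    exact ⟨-1, 1, y, h, by decide, by decide, he⟩
  have htwo : (2 : ℕ) • offPoint k = 0 := by
    rw [two_smul]
    nth_rewrite 1 [← neg_offPoint]
    exact neg_add_cancel _
  intro hg
  -- Twice the centre point has order two, so four times it vanishes; subtracting it does not affect
  -- the infinite order of the black point.
  have hc : IsOfFinAddOrder (centerPoint hs) := by
    refine isOfFinAddOrder_iff_nsmul_eq_zero.mpr ⟨4, by norm_num, ?_⟩
    rw [show 4 = 2 * 2 by rfl, mul_smul, two_smul ℕ (centerPoint hs), centerPoint_add_self, htwo]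
  have hb : IsOfFinAddOrder (blackPoint hs) := by
    have := hg.add hc
    rwa [generator, sub_add_cancel] at this
  exact hlev.not_isOfFinAddOrder (hb.add hb)

end Points

/-! ### Flips and signs -/

theorem flipAt_flipAt_self (v : Vertex) (j : Fin 5) : flipAt (flipAt v j) j = v := by
  funext i
  by_cases h : i = j <;> simp [flipAt, Function.update_apply, h]

theorem flipAt_comm (v : Vertex) (i j : Fin 5) :
    flipAt (flipAt v i) j = flipAt (flipAt v j) i := by
  by_cases hij : i = j
  · rw [hij]
  · simp only [flipAt]
    rw [Function.update_of_ne (Ne.symm hij), Function.update_of_ne hij,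
      Function.update_comm hij]

theorem flipAt_same (v : Vertex) (j : Fin 5) : flipAt v j j = !(v j) := by
  simp [flipAt]

theorem flipAt_of_ne (v : Vertex) {i j : Fin 5} (h : i ≠ j) : flipAt v j i = v i := by
  simp [flipAt, h]

theorem flipAt_ne_self (v : Vertex) (j : Fin 5) : flipAt v j ≠ v := fun h => by
  have := congrFun h j
  simp [flipAt_same] at this

theorem sum_flipAt {M : Type*} [AddCommMonoid M] (j : Fin 5) (F : Vertex → M) :
    ∑ v, F (flipAt v j) = ∑ v, F v :=
  Equiv.sum_comp (Function.Involutive.toPerm _ fun v => flipAt_flipAt_self v j) F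

instance (v : Vertex) : Decidable (IsWhite v) := by
  unfold IsWhite; infer_instance

/-- `-1` for an entry `1`, and `1` for an entry `0`. -/
def bitSign (b : Bool) : ℤ := if b then -1 else 1

theorem bitSign_not (b : Bool) : bitSign (!b) = -bitSign b := by
  cases b <;> simp [bitSign]

theorem abs_bitSign (b : Bool) : |bitSign b| = 1 := by
  cases b <;> simp [bitSign]

/-- `1` for a black vertex, and `-1` for a white one. -/
def parity (v : Vertex) : ℤ := ∏ j, bitSign (v j)

theorem parity_flipAt (v : Vertex) (j : Fin 5) : parity (flipAt v j) = -parity v := by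
  revert v j; decide +kernel

theorem abs_parity (v : Vertex) : |parity v| = 1 := by
  simp [parity, Finset.abs_prod, abs_bitSign]

theorem parity_eq (v : Vertex) : parity v = if IsWhite v then -1 else 1 := by
  revert v; decide +kernel

theorem isWhite_flipAt (v : Vertex) (j : Fin 5) : IsWhite (flipAt v j) ↔ ¬ IsWhite v := by
  revert v j; decide +kernel

/-- The sign of the image of `v` under the map that is unramified at the centres of the faces with
colours `J, J + 1`. It is constant on each of these faces. -/
def faceSign (J : Fin 5) (v : Vertex) : ℤ := bitSign (v (J + 2)) * bitSign (v (J + 4))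

theorem faceSign_flipAt (J : Fin 5) (v : Vertex) (j : Fin 5) :
    faceSign J (flipAt v j) = if j = J + 2 ∨ j = J + 4 then -faceSign J v else faceSign J v := by
  have h : J + 2 ≠ J + 4 := by revert J; decide
  unfold faceSign
  by_cases h2 : j = J + 2
  · subst h2
    rw [flipAt_same, flipAt_of_ne _ h.symm, bitSign_not]; simp
  · by_cases h4 : j = J + 4
    · subst h4
      rw [flipAt_same, flipAt_of_ne _ h, bitSign_not]; simp
    · rw [flipAt_of_ne _ (Ne.symm h2), flipAt_of_ne _ (Ne.symm h4)]; simp [h2, h4]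

theorem faceSign_flipAt_left (J : Fin 5) (v : Vertex) : faceSign J (flipAt v J) = faceSign J v := by
  rw [faceSign_flipAt, if_neg]; revert J; decide

theorem faceSign_flipAt_right (J : Fin 5) (v : Vertex) :
    faceSign J (flipAt v (J + 1)) = faceSign J v := by
  rw [faceSign_flipAt, if_neg]; revert J; decide

theorem faceSign_flipAt_three (J : Fin 5) (v : Vertex) :
    faceSign J (flipAt v (J + 3)) = faceSign J v := by
  rw [faceSign_flipAt, if_neg]; revert J; decide

/-- For `j ≠ J` exactly one of the colours `j, j + 1` is among `J + 2, J + 4`. This is what removes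
the faces of the other four kinds from all signed sums. -/
theorem faceSign_flipAt_flipAt {J j : Fin 5} (h : j ≠ J) (v : Vertex) :
    faceSign J (flipAt (flipAt v j) (j + 1)) = -faceSign J v := by
  revert J j v; decide +kernel

theorem abs_faceSign (J : Fin 5) (v : Vertex) : |faceSign J v| = 1 := by
  simp [faceSign, abs_mul, abs_bitSign]

theorem faceSign_corner (f : Face) (i : Fin 4) :
    faceSign f.1.1 (corner f i) = faceSign f.1.1 f.1.2 := by
  fin_cases i <;> simp [corner, faceSign_flipAt_left, faceSign_flipAt_right]

/-! ### Local shape of height functions -/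

/-- The height difference along the edge of colour `j` at `v`. -/
def slopeAt (h : Height) (v : Vertex) (j : Fin 5) : ℤ := h (flipAt v j) - h v

theorem slopeAt_eq (h : Height) (v : Vertex) (j : Fin 5) :
    slopeAt h v j = 1 ∨ slopeAt h v j = -1 :=
  (abs_eq zero_le_one).mp (h.step v j)

/-- `1` if the slopes in the directions `j` and `j + 1` at `v` agree, and `-1` otherwise. -/
def turn (h : Height) (v : Vertex) (j : Fin 5) : ℤ := slopeAt h v j * slopeAt h v (j + 1)

theorem abs_turn (h : Height) (v : Vertex) (j : Fin 5) : |turn h v j| = 1 := by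
  unfold turn
  rcases slopeAt_eq h v j with h1 | h1 <;> rcases slopeAt_eq h v (j + 1) with h2 | h2 <;>
    simp [h1, h2]

/-- Each sign change around `v` is a turn `-1`, so there are `(5 - ∑ turn) / 2` of them. Their
number is even around a cycle, so the integer division in the coefficient is exact. -/
theorem four_mul_vertexCoeff (h : Height) (v : Vertex) :
    4 * vertexCoeff h v = 1 - ∑ j, turn h v j := by
  have key : ∀ b : Fin 5 → Bool,
      4 * (((Finset.univ.filter fun i : Fin 5 => b i ≠ b (i + 1)).card : ℤ) / 2 - 1) =
        1 - ∑ j, bitSign (b j) * bitSign (b (j + 1)) := by decide +kernel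
  have hs : ∀ j, slopeAt h v j = bitSign (decide (slopeAt h v j = -1)) := by
    intro j
    rcases slopeAt_eq h v j with h1 | h1 <;> simp [h1, bitSign]
  have hq : ∀ j, (h (flipAt v j) : ℚ) - h v = (slopeAt h v j : ℤ) := by
    intro j; simp [slopeAt]
  have := key fun j => decide (slopeAt h v j = -1)
  simp only [← hs] at this
  rw [vertexCoeff, morseCoeff, signChanges]
  simp only [turn, ← this]
  congr! 6 with i
  rw [hq, hq]
  rcases slopeAt_eq h v i with h1 | h1 <;> rcases slopeAt_eq h v (i + 1) with h2 | h2 <;>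
    simp [h1, h2, sign_neg]

/-- A turn is `1` exactly when the two neighbouring corners of the face have equal heights, and
opposite corners of a face have the same two neighbours. -/
theorem turn_opposite (h : Height) (v : Vertex) (j : Fin 5) :
    turn h (flipAt (flipAt v j) (j + 1)) j = turn h v j := by
  have e1 := slopeAt_eq h v j
  have e2 := slopeAt_eq h v (j + 1)
  have e3 := slopeAt_eq h (flipAt v j) (j + 1)
  have e4 := slopeAt_eq h (flipAt v (j + 1)) j
  unfold turn
  unfold slopeAt at *
  rw [flipAt_flipAt_self, flipAt_comm (flipAt v j), flipAt_flipAt_self]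
  rw [flipAt_comm v (j + 1) j] at e4
  generalize (h v : ℤ) = a at *
  generalize (h (flipAt v j) : ℤ) = b at *
  generalize (h (flipAt v (j + 1)) : ℤ) = c at *
  generalize (h (flipAt (flipAt v j) (j + 1)) : ℤ) = d at *
  rw [← neg_sub d c, ← neg_sub d b]
  rcases e1 with e1 | e1 <;> rcases e2 with e2 | e2 <;> rcases e3 with e3 | e3 <;>
    rcases e4 with e4 | e4 <;> first | omega | simp [e1, e2, e3, e4]

theorem corner_step (h : Height) (f : Face) (i : Fin 4) :
    |(h (corner f (i + 1)) : ℤ) - h (corner f i)| = 1 := by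
  fin_cases i
  · exact h.step _ _
  · exact h.step _ _
  · have := h.step (flipAt (flipAt f.1.2 f.1.1) (f.1.1 + 1)) f.1.1
    rw [flipAt_comm (flipAt _ _), flipAt_flipAt_self] at this
    exact this
  · have := h.step (flipAt f.1.2 (f.1.1 + 1)) (f.1.1 + 1)
    rw [flipAt_flipAt_self] at this
    exact this

/-- Consecutive corners have different heights, so unequal opposite corners would produce a third
value. -/
theorem isBowTie_iff (h : Height) (f : Face) :
    IsBowTie h f ↔ h (corner f 0) = h (corner f 2) ∧ h (corner f 1) = h (corner f 3) := by
  have h0 := corner_step h f 0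
  have h1 := corner_step h f 1
  have h2 := corner_step h f 2
  have h3 := corner_step h f 3
  simp only [zero_add, Fin.reduceAdd] at h0 h1 h2 h3
  have himg : (Finset.univ.image fun i => h (corner f i)) =
      {h (corner f 0), h (corner f 1), h (corner f 2), h (corner f 3)} := by
    ext x
    simp [Fin.exists_fin_succ, eq_comm]
  unfold IsBowTie
  rw [himg]
  generalize h (corner f 0) = a at *
  generalize h (corner f 1) = b at *
  generalize h (corner f 2) = c at *
  generalize h (corner f 3) = d at *
  have hab : a ≠ b := by rintro rfl; simp at h0
  have hbc : b ≠ c := by rintro rfl; simp at h1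
  have hcd : c ≠ d := by rintro rfl; simp at h2
  have hda : d ≠ a := by rintro rfl; simp at h3
  constructor
  · intro hc
    refine ⟨?_, ?_⟩ <;> by_contra hne
    · have : ({a, b, c} : Finset ℕ).card ≤ ({a, b, c, d} : Finset ℕ).card :=
        Finset.card_le_card (by intro x; simp only [Finset.mem_insert, Finset.mem_singleton]; tauto)
      rw [Finset.card_eq_three.mpr ⟨a, b, c, hab, hne, hbc, rfl⟩] at this
      omega
    · have : ({b, c, d} : Finset ℕ).card ≤ ({a, b, c, d} : Finset ℕ).card :=
        Finset.card_le_card (by intro x; simp only [Finset.mem_insert, Finset.mem_singleton]; tauto)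
      rw [Finset.card_eq_three.mpr ⟨b, c, d, hbc, hne, hcd, rfl⟩] at this
      omega
  · rintro ⟨rfl, rfl⟩
    rw [show ({a, b, a, b} : Finset ℕ) = {a, b} by ext x; simp, Finset.card_pair hab]

theorem faceCoeff_of_isBowTie {h : Height} {f : Face} (hf : IsBowTie h f) : faceCoeff h f = 1 := by
  obtain ⟨h02, h13⟩ := (isBowTie_iff h f).mp hf
  have h0 := corner_step h f 0
  rw [zero_add] at h0
  have key : ∀ i : Fin 4, SignType.sign ((h (corner f i) : ℚ) - (∑ i, (h (corner f i) : ℚ)) / 4) ≠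
      SignType.sign ((h (corner f (i + 1)) : ℚ) - (∑ i, (h (corner f i) : ℚ)) / 4) := by
    rw [Fin.sum_univ_four, ← h02, ← h13]
    rcases (abs_eq zero_le_one).mp h0 with h0 | h0
    · have e : (h (corner f 1) : ℚ) = h (corner f 0) + 1 := by
        have : (h (corner f 1) : ℤ) = h (corner f 0) + 1 := by omega
        exact_mod_cast this
      have hlo : (h (corner f 0) : ℚ) - (h (corner f 0) + h (corner f 1) + h (corner f 0) +
        h (corner f 1)) / 4 < 0 := by rw [e]; linarith
      have hhi : 0 < (h (corner f 1) : ℚ) - (h (corner f 0) + h (corner f 1) + h (corner f 0) +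
        h (corner f 1)) / 4 := by rw [e]; linarith
      intro i
      fin_cases i <;> simp [← h02, ← h13, sign_neg hlo, sign_pos hhi]
    · have e : (h (corner f 0) : ℚ) = h (corner f 1) + 1 := by
        have : (h (corner f 0) : ℤ) = h (corner f 1) + 1 := by omega
        exact_mod_cast this
      have hlo : (h (corner f 1) : ℚ) - (h (corner f 0) + h (corner f 1) + h (corner f 0) +
        h (corner f 1)) / 4 < 0 := by rw [e]; linarith
      have hhi : 0 < (h (corner f 0) : ℚ) - (h (corner f 0) + h (corner f 1) + h (corner f 0) +
        h (corner f 1)) / 4 := by rw [e]; linarith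
      intro i
      fin_cases i <;> simp [← h02, ← h13, sign_neg hlo, sign_pos hhi]
  rw [faceCoeff, if_pos hf, morseCoeff, signChanges, Finset.filter_true_of_mem fun i _ => key i]
  simp

theorem faceCoeff_of_not_isBowTie {h : Height} {f : Face} (hf : ¬ IsBowTie h f) :
    faceCoeff h f = 0 := by
  rw [faceCoeff, if_neg hf]

theorem turn_corner (h : Height) (f : Face) : ∀ i, turn h (corner f i) f.1.1 =
    ((h (corner f (i + 1)) : ℤ) - h (corner f i)) * (h (corner f (i - 1)) - h (corner f i)) := by
  intro i
  fin_cases i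
  · rfl
  · simp [turn, slopeAt, corner, flipAt_flipAt_self, mul_comm]
  · simp [turn, slopeAt, corner, flipAt_flipAt_self, flipAt_comm (flipAt f.1.2 f.1.1)]
  · simp [turn, slopeAt, corner, flipAt_flipAt_self, flipAt_comm _ (f.1.1 + 1), mul_comm]

/-- In a bow tie all four turns are `1`. In a diamond the turns at the lowest and highest corners
are `1` and the other two are `-1`. -/
theorem four_mul_faceCoeff (h : Height) (f : Face) :
    4 * faceCoeff h f = ∑ i, turn h (corner f i) f.1.1 := by
  have h0 := corner_step h f 0
  have h1 := corner_step h f 1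
  have h2 := corner_step h f 2
  have h3 := corner_step h f 3
  have hb := isBowTie_iff h f
  simp only [turn_corner]
  rw [Fin.sum_univ_four]
  simp only [zero_add, Fin.reduceAdd, Fin.reduceSub, zero_sub, sub_self,
    show (-1 : Fin 4) = 3 from rfl] at *
  by_cases hf : IsBowTie h f
  · rw [faceCoeff_of_isBowTie hf]
    obtain ⟨e1, e2⟩ := hb.mp hf
    rw [← e1, ← e2]
    rcases (abs_eq zero_le_one).mp h0 with h0 | h0 <;> rw [← neg_sub] at h0 <;> grind
  · rw [faceCoeff_of_not_isBowTie hf]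
    rw [hb] at hf
    generalize h (corner f 0) = a at *
    generalize h (corner f 1) = b at *
    generalize h (corner f 2) = c at *
    generalize h (corner f 3) = d at *
    rcases (abs_eq zero_le_one).mp h0 with h0 | h0 <;>
    rcases (abs_eq zero_le_one).mp h1 with h1 | h1 <;>
    rcases (abs_eq zero_le_one).mp h2 with h2 | h2 <;>
    rcases (abs_eq zero_le_one).mp h3 with h3 | h3 <;> first | omega | grind

/-- The sum of the four heights is divisible by `4` for a diamond and congruent to `2` modulo `4`
for a bow tie, so sums of heights detect the parity of the number of bow ties. -/
theorem exists_sum_corner (h : Height) (f : Face) :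
    ∃ m : ℤ, ∑ i, (h (corner f i) : ℤ) = 2 * faceCoeff h f + 4 * m := by
  have h0 := corner_step h f 0
  have h1 := corner_step h f 1
  have h2 := corner_step h f 2
  have h3 := corner_step h f 3
  have hb := isBowTie_iff h f
  rw [Fin.sum_univ_four]
  simp only [zero_add, Fin.reduceAdd] at *
  by_cases hf : IsBowTie h f
  · rw [faceCoeff_of_isBowTie hf]
    obtain ⟨e1, e2⟩ := hb.mp hf
    rw [← e1, ← e2]
    rcases (abs_eq zero_le_one).mp h0 with h0 | h0
    · exact ⟨h (corner f 0), by omega⟩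
    · exact ⟨h (corner f 1), by omega⟩
  · rw [faceCoeff_of_not_isBowTie hf]
    rw [hb] at hf
    refine ⟨(h (corner f 0) + h (corner f 1) + h (corner f 2) + h (corner f 3)) / 4, ?_⟩
    rcases (abs_eq zero_le_one).mp h0 with h0 | h0 <;>
    rcases (abs_eq zero_le_one).mp h1 with h1 | h1 <;>
    rcases (abs_eq zero_le_one).mp h2 with h2 | h2 <;>
    rcases (abs_eq zero_le_one).mp h3 with h3 | h3 <;> omega

/-! ### Sums over faces -/

theorem exists_face_corner (j : Fin 5) (v : Vertex) :
    ∃ (f : Face) (i : Fin 4), f.1.1 = j ∧ corner f i = v := by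
  have hj : j + 1 ≠ j := by revert j; decide
  by_cases h0 : v j = false <;> by_cases h1 : v (j + 1) = false
  · exact ⟨⟨(j, v), h0, h1⟩, 0, rfl, rfl⟩
  · refine ⟨⟨(j, flipAt v (j + 1)), ?_, ?_⟩, 3, rfl, ?_⟩
    · simpa [flipAt_of_ne _ hj.symm] using h0
    · simpa [flipAt_same] using h1
    · exact flipAt_flipAt_self _ _
  · refine ⟨⟨(j, flipAt v j), ?_, ?_⟩, 1, rfl, ?_⟩
    · simpa [flipAt_same] using h0
    · simpa [flipAt_of_ne _ hj] using h1
    · exact flipAt_flipAt_self _ _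
  · refine ⟨⟨(j, flipAt (flipAt v j) (j + 1)), ?_, ?_⟩, 2, rfl, ?_⟩
    · simpa [flipAt_of_ne _ hj.symm, flipAt_same] using h0
    · simpa [flipAt_of_ne _ hj, flipAt_same] using h1
    · change flipAt (flipAt (flipAt (flipAt v j) (j + 1)) j) (j + 1) = v
      rw [flipAt_comm (flipAt v j), flipAt_flipAt_self, flipAt_flipAt_self]

theorem card_face : Fintype.card Face = 40 := by
  decide +kernel

/-- Faces of one kind partition the vertices. Surjectivity suffices, since there are `40 · 4 = 5 ·
32` pairs on both sides. -/
theorem sum_face_corner {M : Type*} [AddCommMonoid M] (F : Fin 5 → Vertex → M) :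
    ∑ f : Face, ∑ i, F f.1.1 (corner f i) = ∑ j, ∑ v, F j v := by
  rw [← Fintype.sum_prod_type', ← Fintype.sum_prod_type']
  refine Fintype.sum_bijective (fun p : Face × Fin 4 => (p.1.1.1, corner p.1 p.2)) ?_ _ _
    fun _ => rfl
  rw [Fintype.bijective_iff_surjective_and_card]
  refine ⟨?_, by simp [card_face]⟩
  rintro ⟨j, v⟩
  obtain ⟨f, i, rfl, rfl⟩ := exists_face_corner j v
  exact ⟨(f, i), rfl⟩

theorem sum_face_type {M : Type*} [AddCommMonoid M] (j : Fin 5) (F : Vertex → M) :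
    ∑ f : Face with f.1.1 = j, ∑ i, F (corner f i) = ∑ v, F v := by
  have h : ∑ j', ∑ v, (if j' = j then F v else 0) = ∑ v, F v := by
    rw [Finset.sum_comm]; simp
  rw [← h, ← sum_face_corner fun j' v => if j' = j then F v else 0, Finset.sum_filter]
  refine Finset.sum_congr rfl fun f _ => ?_
  split_ifs <;> simp

/-- The number of bow ties with colours `j, j + 1`. -/
noncomputable def bowTies (h : Height) (j : Fin 5) : ℤ :=
  ∑ f : Face with f.1.1 = j, faceCoeff h f

/-- The sum of all heights can be computed from the faces of any one kind; modulo `4` it is twice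
the number of bow ties of that kind. -/
theorem exists_bowTies_sub (h : Height) (i j : Fin 5) :
    ∃ m : ℤ, bowTies h i = bowTies h j + 2 * m := by
  choose m hm using exists_sum_corner h
  have key : ∀ j, ∑ v, (h v : ℤ) = 2 * bowTies h j + 4 * ∑ f : Face with f.1.1 = j, m f := by
    intro j
    rw [← sum_face_type j, bowTies, Finset.mul_sum, Finset.mul_sum, ← Finset.sum_add_distrib]
    exact Finset.sum_congr rfl fun f _ => hm f
  have h1 := key i
  have h2 := key j
  exact ⟨(∑ f : Face with f.1.1 = j, m f) - ∑ f : Face with f.1.1 = i, m f, by linarith⟩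

/-! ### The coefficient of a height function -/

theorem sum_eq_zero_of_neg {F : Vertex → ℤ} (e : Vertex → Vertex) (he : Function.Involutive e)
    (hF : ∀ v, F (e v) = -F v) : ∑ v, F v = 0 := by
  have := Equiv.sum_comp (Function.Involutive.toPerm e he) F
  simp only [Function.Involutive.coe_toPerm, hF, Finset.sum_neg_distrib] at this
  linarith

theorem flipAt_flipAt_involutive (i j : Fin 5) :
    Function.Involutive fun v => flipAt (flipAt v i) j := fun v => by
  simp only
  rw [flipAt_comm v, flipAt_flipAt_self, flipAt_flipAt_self]

/-- For a function `w` of the vertices that is constant on the vertices of one colour, only the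
faces with colours `J, J + 1` contribute to the sum of the vertex coefficients with signs. -/
theorem four_mul_sum_vertexCoeff (h : Height) (J : Fin 5) (w : Vertex → ℤ)
    (hw : ∀ v i j, w (flipAt (flipAt v i) j) = w v) :
    4 * ∑ v, w v * faceSign J v * vertexCoeff h v = -∑ v, w v * faceSign J v * turn h v J := by
  have h0 : ∑ v, w v * faceSign J v = 0 := by
    have hJ : J + 1 ≠ J := by revert J; decide
    refine sum_eq_zero_of_neg _ (flipAt_flipAt_involutive (J + 1) (J + 1 + 1)) fun v => ?_
    rw [hw, faceSign_flipAt_flipAt hJ, mul_neg]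
  -- Exchanging opposite corners of the faces with colours `j, j + 1` preserves `w` and the turn,
  -- but reverses `faceSign J`.
  have h1 : ∀ j ≠ J, ∑ v, w v * faceSign J v * turn h v j = 0 := by
    intro j hj
    refine sum_eq_zero_of_neg _ (flipAt_flipAt_involutive j (j + 1)) fun v => ?_
    rw [hw, faceSign_flipAt_flipAt hj, turn_opposite]; ring
  have h2 : ∑ j, ∑ v, w v * faceSign J v * turn h v j = ∑ v, w v * faceSign J v * turn h v J :=
    Finset.sum_eq_single J (fun j _ hj => h1 j hj) (by simp)
  rw [← h2, Finset.sum_comm, Finset.mul_sum]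
  rw [← zero_sub, ← h0, ← Finset.sum_sub_distrib]
  refine Finset.sum_congr rfl fun v _ => ?_
  rw [← Finset.mul_sum]
  linear_combination w v * faceSign J v * four_mul_vertexCoeff h v

/-- The multiple of the generator to which the divisor of `h` is sent by the map that is unramified
at the centres of the faces with colours `J, J + 1`. -/
def amplitude (J : Fin 5) (h : Height) : ℤ := ∑ v, parity v * faceSign J v * vertexCoeff h v

theorem parity_flipAt_flipAt (v : Vertex) (i j : Fin 5) :
    parity (flipAt (flipAt v i) j) = parity v := by
  rw [parity_flipAt, parity_flipAt, neg_neg]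

theorem four_mul_amplitude (J : Fin 5) (h : Height) :
    4 * amplitude J h = -∑ v, parity v * faceSign J v * turn h v J :=
  four_mul_sum_vertexCoeff h J parity parity_flipAt_flipAt

/-- This is the total multiple of the centre point. Both sums are a quarter of the signed sum of
turns in the faces with colours `J, J + 1`, with opposite signs. -/
theorem sum_vertexCoeff_add_sum_faceCoeff (J : Fin 5) (h : Height) :
    ∑ v, faceSign J v * vertexCoeff h v +
      ∑ f : Face with f.1.1 = J, faceSign J f.1.2 * faceCoeff h f = 0 := by
  have h1 := four_mul_sum_vertexCoeff h J (fun _ => 1) fun _ _ _ => rfl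
  simp only [one_mul] at h1
  have h2 : 4 * ∑ f : Face with f.1.1 = J, faceSign J f.1.2 * faceCoeff h f =
      ∑ v, faceSign J v * turn h v J := by
    rw [← sum_face_type J, Finset.mul_sum]
    refine Finset.sum_congr rfl fun f hf => ?_
    obtain rfl : f.1.1 = J := by simpa using hf
    simp only [faceSign_corner, ← Finset.mul_sum]
    linear_combination faceSign f.1.1 f.1.2 * four_mul_faceCoeff h f
  linarith

theorem turn_alternating_le (h : Height) (v : Vertex) (j : Fin 5) :
    |turn h v j - turn h (flipAt v j) j - turn h (flipAt v (j + 1)) j +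
      turn h (flipAt (flipAt v j) (j + 1)) j| ≤ 4 := by
  have h1 := abs_le.mp (abs_turn h v j).le
  have h2 := abs_le.mp (abs_turn h (flipAt v j) j).le
  have h3 := abs_le.mp (abs_turn h (flipAt v (j + 1)) j).le
  have h4 := abs_le.mp (abs_turn h (flipAt (flipAt v j) (j + 1)) j).le
  exact abs_le.mpr ⟨by linarith, by linarith⟩

/-- Averaging over the four corners of a face turns its contribution into an alternating sum of
turns, which is zero for a bow tie and `±4` for a diamond. The proof needs only the bound `4` for
each of the `32` vertices, against a factor `16`. -/
theorem abs_amplitude_le (J : Fin 5) (h : Height) : |amplitude J h| ≤ 8 := by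
  have h0 := four_mul_amplitude J h
  have h1 : ∑ v, parity v * faceSign J v * turn h v J =
      -∑ v, parity v * faceSign J v * turn h (flipAt v J) J := by
    rw [← sum_flipAt J, ← Finset.sum_neg_distrib]
    refine Finset.sum_congr rfl fun v _ => ?_
    rw [parity_flipAt, faceSign_flipAt_left]; ring
  have h2 : ∑ v, parity v * faceSign J v * turn h v J =
      -∑ v, parity v * faceSign J v * turn h (flipAt v (J + 1)) J := by
    rw [← sum_flipAt (J + 1), ← Finset.sum_neg_distrib]
    refine Finset.sum_congr rfl fun v _ => ?_
    rw [parity_flipAt, faceSign_flipAt_right]; ring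
  have h4 : 16 * amplitude J h = -∑ v, parity v * faceSign J v * (turn h v J -
      turn h (flipAt v J) J - turn h (flipAt v (J + 1)) J +
      turn h (flipAt (flipAt v J) (J + 1)) J) := by
    simp only [mul_add, mul_sub, Finset.sum_add_distrib, Finset.sum_sub_distrib, turn_opposite]
    linarith
  have h5 : |16 * amplitude J h| ≤ 128 := by
    rw [h4, abs_neg]
    refine (Finset.abs_sum_le_sum_abs _ _).trans ?_
    have : ∀ v ∈ Finset.univ, |parity v * faceSign J v * (turn h v J -
      turn h (flipAt v J) J - turn h (flipAt v (J + 1)) J +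
      turn h (flipAt (flipAt v J) (J + 1)) J)| ≤ 4 := by
      intro v _
      rw [abs_mul, abs_mul, abs_parity, abs_faceSign, one_mul, one_mul]
      exact turn_alternating_le h v J
    refine (Finset.sum_le_card_nsmul _ _ _ this).trans ?_
    simp
  rw [abs_mul] at h5
  norm_num at h5
  linarith

/-! ### Lowering a vertex -/

theorem Lowers.slopeAt_self {v : Vertex} {h h' : Height} (hl : Lowers v h h') (j : Fin 5) :
    slopeAt h v j = -1 ∧ slopeAt h' v j = 1 := by
  have h1 := slopeAt_eq h v j
  have h2 := slopeAt_eq h' v j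
  unfold slopeAt at *
  rw [hl.2 _ (flipAt_ne_self v j)] at h2 ⊢
  have := hl.1
  omega

/-- The lowered vertex lies on just one face with colours `J, J + 1`, and on that face diamond and
bow tie are exchanged. Only the turns at the two neighbours of `v` change: both slopes at `v` are
reversed, and the opposite corner has the same turn as `v`. -/
theorem abs_amplitude_sub_of_lowers (J : Fin 5) {v : Vertex} {h h' : Height}
    (hl : Lowers v h h') : |amplitude J h - amplitude J h'| = 1 := by
  have hJ : J + 1 ≠ J := by revert J; decide
  have hne : flipAt v J ≠ flipAt v (J + 1) := fun he => by
    have := congrFun he J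
    rw [flipAt_same, flipAt_of_ne _ hJ.symm] at this
    simp at this
  have hw1 : flipAt (flipAt v J) (J + 1) ≠ v := fun he => by
    have := congrFun he J
    rw [flipAt_of_ne _ hJ.symm, flipAt_same] at this
    simp at this
  have h1 : ∑ u, parity u * faceSign J u * (turn h u J - turn h' u J) =
      parity (flipAt v J) * faceSign J (flipAt v J) *
        (turn h (flipAt v J) J - turn h' (flipAt v J) J) +
      parity (flipAt v (J + 1)) * faceSign J (flipAt v (J + 1)) *
        (turn h (flipAt v (J + 1)) J - turn h' (flipAt v (J + 1)) J) := by
    refine Finset.sum_eq_add _ _ hne (fun u _ hu => ?_) (by simp) (by simp)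
    suffices turn h u J = turn h' u J by rw [this, sub_self, mul_zero]
    by_cases huv : u = v
    · subst huv
      simp [turn, hl.slopeAt_self]
    · have e1 : flipAt u J ≠ v := fun he => hu.1 (by rw [← he, flipAt_flipAt_self])
      have e2 : flipAt u (J + 1) ≠ v := fun he => hu.2 (by rw [← he, flipAt_flipAt_self])
      simp only [turn, slopeAt]
      rw [hl.2 u huv, hl.2 _ e1, hl.2 _ e2]
  have h4 : 4 * (amplitude J h - amplitude J h') =
      -∑ u, parity u * faceSign J u * (turn h u J - turn h' u J) := by
    simp only [mul_sub, Finset.sum_sub_distrib, four_mul_amplitude]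
    ring
  rw [h1, parity_flipAt, parity_flipAt, faceSign_flipAt_left, faceSign_flipAt_right] at h4
  have hw2 : flipAt (flipAt v (J + 1)) J = flipAt (flipAt v J) (J + 1) := flipAt_comm _ _ _
  have a1 := (hl.slopeAt_self J)
  have a2 := (hl.slopeAt_self (J + 1))
  have b1 := slopeAt_eq h (flipAt v J) (J + 1)
  simp only [turn, slopeAt, flipAt_flipAt_self, hw2, hl.2 _ hw1, hl.2 _ (flipAt_ne_self v _)] at *
  have hs : |parity v * faceSign J v| = 1 := by rw [abs_mul, abs_parity, abs_faceSign, one_mul]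
  have e1 : (h (flipAt v J) : ℤ) = h v - 1 := by linarith
  have e2 : (h (flipAt v (J + 1)) : ℤ) = h v - 1 := by linarith
  have e3 : (h' v : ℤ) = h v - 2 := by have := hl.1; omega
  rw [e1, e2, e3] at h4
  rw [e1] at b1
  have h5 : amplitude J h - amplitude J h' =
      parity v * faceSign J v * (h (flipAt (flipAt v J) (J + 1)) - (h v - 1)) := by
    apply mul_left_cancel₀ (four_ne_zero' ℤ)
    linear_combination h4
  rw [h5, abs_mul, hs, one_mul]
  exact (abs_eq zero_le_one).mpr b1

/-! ### Fully extended height functions -/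

theorem hammingDist_flipAt {u v : Vertex} {j : Fin 5} (h : u j ≠ v j) :
    hammingDist (flipAt u j) v + 1 = hammingDist u v := by
  have hj : j ∈ Finset.univ.filter fun i => u i ≠ v i := by simpa using h
  unfold hammingDist
  rw [← Finset.card_erase_add_one hj]
  congr 2
  ext i
  by_cases hi : i = j
  · subst hi
    simp only [Finset.mem_filter, Finset.mem_univ, true_and, flipAt_same, Finset.mem_erase,
      ne_eq, not_true_eq_false, false_and, iff_false, not_not]
    revert h; cases u i <;> cases v i <;> simp
  · simp [flipAt_of_ne _ hi, hi]

theorem Height.abs_sub_le (h : Height) (v : Vertex) :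
    ∀ u, |(h u : ℤ) - h v| ≤ hammingDist u v := by
  suffices H : ∀ (n : ℕ) (u : Vertex), hammingDist u v = n → |(h u : ℤ) - h v| ≤ n from
    fun u => H _ u rfl
  intro n
  induction n with
  | zero =>
    intro u hu
    rw [hammingDist_eq_zero] at hu
    simp [hu]
  | succ n ih =>
    intro u hu
    obtain ⟨j, hj⟩ : ∃ j, u j ≠ v j := by
      by_contra! hne
      rw [funext hne, hammingDist_self] at hu
      omega
    have h1 := ih (flipAt u j) (by have := hammingDist_flipAt hj; omega)
    have h2 := _root_.abs_sub_le (h u : ℤ) (h (flipAt u j)) (h v)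
    have h3 := h.step u j
    rw [abs_sub_comm] at h3
    push_cast
    linarith

/-- The height function that counts the entries `1`. -/
def weightHeight : Height where
  toFun v := (Finset.univ.filter fun i => v i = true).card
  step := by decide +kernel

theorem five_le_spread_weightHeight : 5 ≤ spread weightHeight :=
  Finset.le_sup_of_le (Finset.mem_univ ((fun _ => true : Vertex), (fun _ => false : Vertex)))
    (by decide +kernel)

theorem hammingDist_add_of_ne {v w : Vertex} (hvw : ∀ j, v j ≠ w j) (u : Vertex) :
    hammingDist v u + hammingDist u w = 5 := by
  have h := Finset.card_filter_add_card_filter_not (s := (Finset.univ : Finset (Fin 5)))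
    (fun i => v i ≠ u i)
  rw [Finset.card_univ, Fintype.card_fin] at h
  refine Eq.trans ?_ h
  unfold hammingDist
  congr 2
  ext i
  have := hvw i
  revert this
  simp only [Finset.mem_filter, Finset.mem_univ, true_and]
  cases v i <;> cases w i <;> cases u i <;> simp

/-- The height difference is at most the Hamming distance, and the maximal spread is `5`. Hence two
extremal vertices are antipodal, and every other height is squeezed between the distances to them,
which add up to `5`. -/
theorem IsFullyExtended.exists_bottom {h : Height} (hh : IsFullyExtended h) :
    ∃ w, ∀ u, (h u : ℤ) = h w + hammingDist u w := by
  have h5 := five_le_spread_weightHeight.trans (hh weightHeight)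
  obtain ⟨⟨v, w⟩, -, hvw⟩ := (Finset.le_sup_iff (by norm_num)).mp h5
  suffices H : ∀ v w, (5 : ℤ) ≤ h v - h w → ∀ u, (h u : ℤ) = h w + hammingDist u w by
    have hvw : 5 ≤ ((h v : ℤ) - h w).natAbs := hvw
    rcases le_total (0 : ℤ) (h v - h w) with h0 | h0
    · exact ⟨w, H v w (by omega)⟩
    · exact ⟨v, H w v (by omega)⟩
  intro v w hvw u
  have hd : hammingDist v w = 5 := by
    have h1 : hammingDist v w ≤ 5 := hammingDist_le_card_fintype
    have h2 := (abs_le.mp (h.abs_sub_le w v)).2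
    omega
  have hne : ∀ j, v j ≠ w j := by
    have hcard : (Finset.univ.filter fun i => v i ≠ w i).card = (Finset.univ : Finset (Fin 5)).card :=
      hd
    intro j
    have := Finset.mem_univ j
    rw [← Finset.eq_of_subset_of_card_le (Finset.filter_subset _ _) hcard.ge] at this
    exact (Finset.mem_filter.mp this).2
  have h1 := hammingDist_add_of_ne hne u
  have h2 := (abs_le.mp (h.abs_sub_le u v)).2
  have h3 := (abs_le.mp (h.abs_sub_le w u)).2
  omega

theorem amplitude_of_isFullyExtended (J : Fin 5) {h : Height} (hh : IsFullyExtended h) :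
    amplitude J h = 0 := by
  obtain ⟨w, hw⟩ := hh.exists_bottom
  have hs : ∀ u j, slopeAt h u j = if u j = w j then 1 else -1 := by
    intro u j
    unfold slopeAt
    rw [hw, hw u]
    split_ifs with hj
    · have h1 : flipAt u j j ≠ w j := by rw [flipAt_same, hj]; simp
      have := hammingDist_flipAt h1
      rw [flipAt_flipAt_self] at this
      omega
    · have := hammingDist_flipAt hj
      omega
  have h0 : ∑ v, parity v * faceSign J v * turn h v J = 0 := by
    have h1 : J ≠ J + 3 := by revert J; decide
    have h2 : J + 1 ≠ J + 3 := by revert J; decide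
    -- Each slope depends only on the coordinate of its own direction. Flipping `J + 3` thus fixes
    -- the turn and `faceSign J`, and reverses the parity.
    refine sum_eq_zero_of_neg (fun v => flipAt v (J + 3)) (fun v => flipAt_flipAt_self v _)
      fun v => ?_
    rw [parity_flipAt, faceSign_flipAt_three]
    simp only [turn, hs, flipAt_of_ne _ h1, flipAt_of_ne _ h2]
    ring
  have := four_mul_amplitude J h
  omega

/-! ### All values of the coefficient occur -/

/-- A height function on `H⁵` in five bits for which all faces in the directions `x`, `y` are
diamonds, except for `n` of them that are flattened to bow ties. -/
def flattenedValue (n : ℕ) (x y p z r : Bool) : ℕ :=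
  let t := x.toNat + (y ^^ z).toNat + (p ^^ r).toNat
  if 4 * p.toNat + 2 * z.toNat + r.toNat < n then
    if t = 3 then 1 else if t = 0 then 2 else t
  else t

/-- The height function `flattenedValue n`, the first two bits being in the directions
`J, J + 1`. -/
def flattened (J : Fin 5) (n : Fin 9) : Height where
  toFun v := flattenedValue n (v J) (v (J + 1)) (v (J + 2)) (v (J + 3)) (v (J + 4))
  step := by revert J n; decide +kernel

/-- Unflattened, the eight faces are diamonds that all contribute `-1`. Flattening moves the corner
of height `0` or `3` of a face so that only the heights `1, 2` remain, and it removes one such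
contribution. -/
theorem amplitude_flattened (J : Fin 5) (n : Fin 9) :
    amplitude J (flattened J n) = n - 8 := by
  have h : ∑ v, parity v * faceSign J v * turn (flattened J n) v J = -4 * (n - 8) := by
    revert J n; decide +kernel
  have := four_mul_amplitude J (flattened J n)
  omega

/-- The mirror image of a height function in the direction `j`. -/
def Height.reflect (h : Height) (j : Fin 5) : Height where
  toFun v := h (flipAt v j)
  step v i := by rw [flipAt_comm]; exact h.step _ i

theorem vertexCoeff_reflect (h : Height) (v : Vertex) (j : Fin 5) :
    vertexCoeff (h.reflect j) v = vertexCoeff h (flipAt v j) := by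
  unfold vertexCoeff Height.reflect
  simp only [flipAt_comm _ j]

theorem amplitude_reflect (J : Fin 5) (h : Height) :
    amplitude J (h.reflect (J + 3)) = -amplitude J h := by
  unfold amplitude
  rw [← sum_flipAt (J + 3), ← Finset.sum_neg_distrib]
  refine Finset.sum_congr rfl fun v _ => ?_
  rw [vertexCoeff_reflect, flipAt_flipAt_self, parity_flipAt, faceSign_flipAt_three]
  ring

theorem exists_amplitude_eq (J : Fin 5) {a : ℤ} (h1 : -8 ≤ a) (h2 : a ≤ 8) :
    ∃ h : Height, amplitude J h = a := by
  rcases le_total a 0 with ha | ha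
  · refine ⟨flattened J ⟨(a + 8).toNat, by omega⟩, ?_⟩
    rw [amplitude_flattened]
    simp only
    omega
  · refine ⟨(flattened J ⟨(-a + 8).toNat, by omega⟩).reflect (J + 3), ?_⟩
    rw [amplitude_reflect, amplitude_flattened]
    simp only
    omega

/-! ### The squares of the coordinates -/

/-- The position on the beach ball of the branch point below `x i = 0`. -/
noncomputable def branch (i : Fin 5) : ℂ := zeta ^ (2 * (i : ℕ) + 9)

/-- The leading coefficient of `x i ^ 2` as a linear form on the beach ball. -/
noncomputable def lead : Fin 5 → ℂ :=
  ![zeta - zeta ^ 3, zeta ^ 3 + zeta ^ 4, -(zeta + zeta ^ 4), -(1 + zeta ^ 3), -(1 + zeta)]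

theorem branch_ne_zero (i : Fin 5) : branch i ≠ 0 := pow_ne_zero _ zeta_ne_zero

theorem lead_ne_zero (i : Fin 5) : lead i ≠ 0 := by
  have h := zeta_cyclotomic
  -- Each leading coefficient divides `5` in `ℤ[ζ]`; the witnesses below are the cofactors.
  have key : ∀ a b : ℂ, a * b = 5 → a ≠ 0 := fun a b hab ha => by simp [ha] at hab
  fin_cases i
  · exact key _ (3 - zeta + 4 * zeta ^ 2 - 2 * zeta ^ 3) (by
      change (zeta - zeta ^ 3) * _ = 5; grind)
  · exact key _ (1 - 2 * zeta - 2 * zeta ^ 2 + zeta ^ 3) (by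
      change (zeta ^ 3 + zeta ^ 4) * _ = 5; grind)
  · exact key _ (-2 + 4 * zeta - zeta ^ 2 + 3 * zeta ^ 3) (by
      change -(zeta + zeta ^ 4) * _ = 5; grind)
  · exact key _ (-3 + zeta + zeta ^ 2 + 2 * zeta ^ 3) (by
      change -(1 + zeta ^ 3) * _ = 5; grind)
  · exact key _ (-4 + 3 * zeta - 2 * zeta ^ 2 + zeta ^ 3) (by
      change -(1 + zeta) * _ = 5; grind)

theorem etaNum_eq (a b : ℂ) : etaNum a b = lead 1 * (a - branch 1 * b) := by
  have h := zeta_pow_five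
  simp only [etaNum, zeta_inv, lead, branch, Matrix.cons_val]
  norm_num
  grind

theorem etaDen_eq (a b : ℂ) : etaDen a b = lead 0 * (a - branch 0 * b) := by
  have h := zeta_pow_five
  simp only [etaDen, zeta_inv, lead, branch, Matrix.cons_val]
  norm_num
  grind

/-- This and the next two identities are the equations of the curve, written for the linear forms
that replace the squares of the coordinates. -/
theorem lead_two (a b : ℂ) : lead 2 * (a - branch 2 * b) =
    -(lead 0 * (a - branch 0 * b) + lead 1 * (a - branch 1 * b)) := by
  have h := zeta_pow_five
  have h' := zeta_cyclotomic
  simp only [lead, branch, Matrix.cons_val]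
  norm_num
  grind

theorem lead_three (a b : ℂ) : lead 3 * (a - branch 3 * b) =
    -(phi * (lead 0 * (a - branch 0 * b)) + lead 1 * (a - branch 1 * b)) := by
  have h := zeta_pow_five
  have h' := zeta_cyclotomic
  simp only [lead, branch, Matrix.cons_val, phi_eq']
  norm_num
  grind

theorem lead_four (a b : ℂ) : lead 4 * (a - branch 4 * b) =
    -((1 + phi) * (lead 0 * (a - branch 0 * b)) + lead 1 * (a - branch 1 * b)) := by
  have h := zeta_pow_five
  have h' := zeta_cyclotomic
  simp only [lead, branch, Matrix.cons_val, phi_eq']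
  norm_num
  grind

theorem etaNum_ne_zero_of_etaDen_eq_zero {a b : ℂ} (hab : a ≠ 0 ∨ b ≠ 0) (h : etaDen a b = 0) :
    etaNum a b ≠ 0 := by
  intro h'
  rw [etaDen_eq, mul_eq_zero, or_iff_right (lead_ne_zero _)] at h
  rw [etaNum_eq, mul_eq_zero, or_iff_right (lead_ne_zero _)] at h'
  have h5 := zeta_pow_five
  have hb : (branch 1 - branch 0) * b = 0 := by linear_combination h - h'
  have hne : branch 1 - branch 0 ≠ 0 := by
    have : branch 1 - branch 0 = -lead 2 := by
      simp only [lead, branch, Matrix.cons_val]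
      norm_num
      grind
    rw [this]
    exact neg_ne_zero.mpr (lead_ne_zero 2)
  have hb0 : b = 0 := (mul_eq_zero.mp hb).resolve_left hne
  rw [hb0, mul_zero, sub_zero] at h
  exact hab.elim (fun ha => ha h) fun hb => hb hb0

theorem exists_sq_eq {x : Fin 5 → ℂ} {a b : ℂ} (hab : a ≠ 0 ∨ b ≠ 0) (hx : OnCurve x)
    (hl : LiesOver x a b) : ∃ μ, ∀ i, x i ^ 2 = μ * (lead i * (a - branch i * b)) := by
  obtain ⟨μ, h0, h1⟩ : ∃ μ, x 0 ^ 2 = μ * etaDen a b ∧ x 1 ^ 2 = μ * etaNum a b := by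
    unfold LiesOver at hl
    by_cases hd : etaDen a b = 0
    · have hn := etaNum_ne_zero_of_etaDen_eq_zero hab hd
      refine ⟨x 1 ^ 2 / etaNum a b, ?_, ?_⟩
      · rw [hd, mul_zero] at hl ⊢
        exact (mul_eq_zero.mp hl.symm).resolve_right hn
      · field_simp
    · refine ⟨x 0 ^ 2 / etaDen a b, by field_simp, ?_⟩
      field_simp
      exact hl
  rw [etaDen_eq] at h0
  rw [etaNum_eq] at h1
  obtain ⟨e1, e2, e3⟩ := hx
  refine ⟨μ, fun i => ?_⟩
  fin_cases i
  · exact h0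
  · exact h1
  · change x 2 ^ 2 = μ * (lead 2 * (a - branch 2 * b))
    rw [lead_two]; linear_combination e1 - h0 - h1
  · change x 3 ^ 2 = μ * (lead 3 * (a - branch 3 * b))
    rw [lead_three]; linear_combination e2 - phi * h0 - h1
  · change x 4 ^ 2 = μ * (lead 4 * (a - branch 4 * b))
    rw [lead_four]; linear_combination e3 - (1 + phi) * h0 - h1

theorem onCurve_of_sq_eq {x : Fin 5 → ℂ} {a b μ : ℂ}
    (h : ∀ i, x i ^ 2 = μ * (lead i * (a - branch i * b))) : OnCurve x := by
  refine ⟨?_, ?_, ?_⟩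
  · rw [h 0, h 1, h 2, lead_two]; ring
  · rw [h 0, h 1, h 3, lead_three]; ring
  · rw [h 0, h 1, h 4, lead_four]; ring

theorem liesOver_of_sq_eq {x : Fin 5 → ℂ} {a b μ : ℂ}
    (h : ∀ i, x i ^ 2 = μ * (lead i * (a - branch i * b))) : LiesOver x a b := by
  unfold LiesOver
  rw [h 0, h 1, etaDen_eq, etaNum_eq]; ring

/-! ### Square roots along rays -/

/-- The principal square root. -/
noncomputable def root (z : ℂ) : ℂ := z ^ (2⁻¹ : ℂ)

theorem root_sq (z : ℂ) : root z ^ 2 = z := Complex.cpow_ofNat_inv_pow z 2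

theorem root_of_sq {u : ℂ} (hu : 0 < u.re) : root (u ^ 2) = u := Complex.sq_cpow_two_inv hu

theorem root_one : root 1 = 1 := by
  simpa using root_of_sq (u := 1) (by simp)

theorem root_ne_zero {z : ℂ} (hz : z ≠ 0) : root z ≠ 0 := fun h => hz (by
  rw [← root_sq z, h]; ring)

theorem sq_mem_slitPlane {u : ℂ} (hu : 0 < u.re) : u ^ 2 ∈ Complex.slitPlane := by
  rw [Complex.mem_slitPlane_iff]
  by_cases h : u.im = 0
  · left
    rw [pow_two, Complex.mul_re, h]
    nlinarith
  · right
    rw [pow_two, Complex.mul_im]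
    intro h'
    apply h
    have : u.re * u.im = 0 := by linarith
    exact (mul_eq_zero.mp this).resolve_left hu.ne'

/-- The segment from `1` to `z`. -/
noncomputable def segmentTo (z : ℂ) (s : ℝ) : ℂ := ((1 - s : ℝ) : ℂ) + s * z

theorem segmentTo_mem {z : ℂ} (hz : z ∈ Complex.slitPlane) {s : ℝ} (hs : s ∈ Set.Icc (0 : ℝ) 1) :
    segmentTo z s ∈ Complex.slitPlane := by
  have := Complex.starConvex_one_slitPlane hz (sub_nonneg.mpr hs.2) hs.1 (by ring)
  simpa [segmentTo] using this

theorem continuousOn_root_segmentTo {z : ℂ} (hz : z ∈ Complex.slitPlane) :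
    ContinuousOn (fun s => root (segmentTo z s)) (Set.Icc 0 1) := by
  intro s hs
  have h1 : ContinuousAt (segmentTo z) s := by unfold segmentTo; fun_prop
  exact ((continuousAt_cpow_const (segmentTo_mem hz hs)).comp h1).continuousWithinAt

theorem segmentTo_zero (z : ℂ) : segmentTo z 0 = 1 := by simp [segmentTo]

theorem segmentTo_one (z : ℂ) : segmentTo z 1 = z := by simp [segmentTo]

theorem sub_branch_eq {i : Fin 5} {d z : ℂ} (hd : d = -branch i * z) (s : ℝ) :
    (s * d - branch i * ((1 - s : ℝ) : ℂ)) = -branch i * segmentTo z s := by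
  rw [hd, segmentTo]; ring

/-- A path on the curve over a ray is determined by its initial point. -/
theorem path_unique {d : ℂ} (hd0 : d ≠ 0) {x : ℝ → Fin 5 → ℂ} {S : ℝ} (hS0 : 0 ≤ S) (hS1 : S ≤ 1)
    (hx : ∀ s, x s ≠ 0) (hc : ContinuousOn x (Set.uIcc 0 S))
    (hon : ∀ s ∈ Set.uIcc 0 S, OnCurve (x s) ∧ LiesOver (x s) (s * d) ((1 - s : ℝ) : ℂ))
    {i l : Fin 5} {z w : ℂ} (hz : z ∈ Complex.slitPlane) (hw : w ∈ Complex.slitPlane)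
    (hdz : d = -branch i * z) (hdw : d = -branch l * w) :
    x S i * (x 0 l * root (segmentTo w S)) = x S l * (x 0 i * root (segmentTo z S)) := by
  rw [Set.uIcc_of_le hS0] at hc hon
  have hsub : Set.Icc 0 S ⊆ Set.Icc (0 : ℝ) 1 := Set.Icc_subset_Icc_right hS1
  have hsq : ∀ s ∈ Set.Icc 0 S, ∃ μ ≠ 0, ∀ i, x s i ^ 2 =
      μ * (lead i * (s * d - branch i * ((1 - s : ℝ) : ℂ))) := by
    intro s hs
    have hab : (s * d : ℂ) ≠ 0 ∨ ((1 - s : ℝ) : ℂ) ≠ 0 := by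
      by_cases h : s = 0
      · right; simp [h]
      · left; simp [h, hd0]
    obtain ⟨μ, hμ⟩ := exists_sq_eq hab (hon s hs).1 (hon s hs).2
    refine ⟨μ, ?_, hμ⟩
    rintro rfl
    apply hx s
    funext i
    have := hμ i
    rw [zero_mul] at this
    exact pow_eq_zero_iff two_ne_zero |>.mp this
  obtain ⟨ν, hν0, hν⟩ := hsq 0 (Set.left_mem_Icc.mpr hS0)
  have hne : ∀ {i : Fin 5} {z : ℂ}, z ∈ Complex.slitPlane → d = -branch i * z →
      ∀ s ∈ Set.Icc 0 S, x s i ≠ 0 := by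
    intro i z hz hdz s hs h
    obtain ⟨μ, hμ0, hμ⟩ := hsq s hs
    have := hμ i
    rw [h, sub_branch_eq hdz] at this
    have h1 := Complex.slitPlane_ne_zero (segmentTo_mem hz (hsub hs))
    have h2 : μ * (lead i * (-branch i * segmentTo z s)) ≠ 0 :=
      mul_ne_zero hμ0 (mul_ne_zero (lead_ne_zero i)
        (mul_ne_zero (neg_ne_zero.mpr (branch_ne_zero i)) h1))
    exact h2 (by rw [← this]; ring)
  have hcx : ∀ i, ContinuousOn (fun s => x s i) (Set.Icc 0 S) := fun i =>
    (continuous_apply i).comp_continuousOn hc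
  have h0S : (0 : ℝ) ∈ Set.Icc 0 S := Set.left_mem_Icc.mpr hS0
  -- The two functions have equal squares and the second has no zero on the interval, so they agree
  -- up to one constant sign. At `s = 0` both roots are `1`, which excludes the minus sign.
  have hiff := isPreconnected_Icc.eq_or_eq_neg_of_sq_eq (S := Set.Icc 0 S)
    (f := fun s => x s i * (x 0 l * root (segmentTo w s)))
    (g := fun s => x s l * (x 0 i * root (segmentTo z s)))
    ((hcx i).mul (continuousOn_const.mul ((continuousOn_root_segmentTo hw).mono hsub)))
    ((hcx l).mul (continuousOn_const.mul ((continuousOn_root_segmentTo hz).mono hsub)))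
    (by
      intro s hs
      obtain ⟨μ, hμ0, hμ⟩ := hsq s hs
      have e1 := hμ i
      have e2 := hμ l
      have e3 := hν i
      have e4 := hν l
      rw [sub_branch_eq hdz] at e1 e3
      rw [sub_branch_eq hdw] at e2 e4
      simp only [Pi.pow_apply, mul_pow, root_sq]
      rw [e1, e2, e3, e4, segmentTo_zero, segmentTo_zero]
      ring)
    (by
      intro s hs
      exact mul_ne_zero (hne hw hdw s hs) (mul_ne_zero (hne hz hdz 0 h0S)
        (root_ne_zero (Complex.slitPlane_ne_zero (segmentTo_mem hz (hsub hs))))))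
  rcases hiff with h | h
  · exact h (Set.right_mem_Icc.mpr hS0)
  · exfalso
    have h1 := h h0S
    simp only [Pi.neg_apply, segmentTo_zero, root_one, mul_one] at h1
    have h2 : x 0 i * x 0 l ≠ 0 := mul_ne_zero (hne hz hdz 0 h0S) (hne hw hdw 0 h0S)
    apply h2
    linear_combination h1 / 2

/-! ### Roots of unity on the rays -/

theorem zeta_pow_re_im (n : ℕ) : (zeta ^ n).re = Real.cos (n * (Real.pi / 5)) ∧
    (zeta ^ n).im = Real.sin (n * (Real.pi / 5)) := by
  rw [zeta_eq, ← Complex.exp_nat_mul, show (n : ℂ) * ((Real.pi / 5 : ℝ) * Complex.I) =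
    ((n * (Real.pi / 5) : ℝ) : ℂ) * Complex.I by push_cast; ring]
  exact ⟨Complex.exp_ofReal_mul_I_re _, Complex.exp_ofReal_mul_I_im _⟩

theorem zeta_pow_im_pos {n : ℕ} (h0 : 0 < n) (h5 : n < 5) : 0 < (zeta ^ n).im := by
  rw [(zeta_pow_re_im n).2]
  have h0' : (0 : ℝ) < n := by exact_mod_cast h0
  have h5' : (n : ℝ) < 5 := by exact_mod_cast h5
  have := Real.pi_pos
  exact Real.sin_pos_of_pos_of_lt_pi (by positivity) (by nlinarith)

theorem zeta_pow_congr {m n : ℕ} (h : m % 10 = n % 10) : zeta ^ m = zeta ^ n := by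
  have h10 : zeta ^ 10 = 1 := by linear_combination (zeta ^ 5 - 1) * zeta_pow_five
  rw [← Nat.div_add_mod m 10, ← Nat.div_add_mod n 10, h]
  simp [pow_add, pow_mul, h10]

theorem neg_zeta_pow (n : ℕ) : -zeta ^ n = zeta ^ (n + 5) := by
  rw [pow_add, zeta_pow_five]; ring

/-- The square root of minus the quotient of the direction `ζ ^ (2 * j + 2)` by `branch i`, as a
function of `j - i - 1`. -/
noncomputable def edgeRoot (m : Fin 5) : ℂ := zeta ^ (![0, 1, 2, 8, 9] m : ℕ)

/-- The exponents are chosen in the right half-plane, so that `edgeRoot m` is the principal root of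
its square and hence the endpoint of the continuous root along the edge. -/
theorem edgeRoot_re_pos (m : Fin 5) : 0 < (edgeRoot m).re := by
  have h1 : (zeta ^ 9).re = zeta.re := by
    rw [← neg_zeta_pow 4, ← star_zeta, Complex.conj_re]
  have h2 : (zeta ^ 8).re = (zeta ^ 2).re := by
    have : zeta ^ 8 = (starRingEnd ℂ) (zeta ^ 2) := by
      rw [map_pow, star_zeta]; ring
    rw [this, Complex.conj_re]
  fin_cases m <;> simp only [edgeRoot, Fin.zero_eta, Fin.mk_one, Fin.reduceFinMk, Matrix.cons_val]
  · simp
  · simpa using zeta_re_pos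
  · exact zeta_sq_re_pos
  · exact h2 ▸ zeta_sq_re_pos
  · exact h1 ▸ zeta_re_pos

theorem edgeRoot_ne_zero (m : Fin 5) : edgeRoot m ≠ 0 := pow_ne_zero _ zeta_ne_zero

theorem edge_direction (i j : Fin 5) :
    zeta ^ (2 * (j : ℕ) + 2) = -branch i * edgeRoot (j - i - 1) ^ 2 := by
  rw [branch, edgeRoot, neg_zeta_pow, ← pow_mul, ← pow_add]
  apply zeta_pow_congr
  revert i j; decide

/-- Minus the quotient of the direction `ζ ^ (2 * J + 3)` by `branch i`, as a function of
`J + 2 - i`. -/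
noncomputable def centerRatio (m : Fin 5) : ℂ := zeta ^ (![5, 7, 9, 1, 3] m : ℕ)

/-- The ray to the centre of a face with colours `J, J + 1` runs through the branch point of `x (J +
2)`, reached at `s = 1 / 2`. This is the only coordinate whose root leaves the slit plane. -/
theorem centerRatio_zero : centerRatio 0 = -1 := zeta_pow_five

theorem centerRatio_im_ne_zero {m : Fin 5} (hm : m ≠ 0) : (centerRatio m).im ≠ 0 := by
  have h (n : ℕ) (h0 : 0 < n) (h5 : n < 5) := (zeta_pow_im_pos h0 h5).ne'
  have h' (n : ℕ) (h0 : 0 < n) (h5 : n < 5) : (zeta ^ (n + 5)).im ≠ 0 := by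
    rw [← neg_zeta_pow, Complex.neg_im]
    exact neg_ne_zero.mpr (h n h0 h5)
  fin_cases m
  · exact absurd rfl hm
  · exact h' 2 (by norm_num) (by norm_num)
  · exact h' 4 (by norm_num) (by norm_num)
  · exact h 1 (by norm_num) (by norm_num)
  · exact h 3 (by norm_num) (by norm_num)

theorem centerRatio_mem {m : Fin 5} (hm : m ≠ 0) : centerRatio m ∈ Complex.slitPlane :=
  Or.inr (centerRatio_im_ne_zero hm)

theorem center_direction (i J : Fin 5) :
    zeta ^ (2 * (J : ℕ) + 3) = -branch i * centerRatio (J + 2 - i) := by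
  rw [branch, centerRatio, neg_zeta_pow, ← pow_add]
  apply zeta_pow_congr
  revert i J; decide

/-! ### Homogeneous coordinates of the vertices and the centres -/

/-- `y` are homogeneous coordinates of `p`. -/
def Represents (p : Curve) (y : Fin 5 → ℂ) : Prop :=
  ∃ hy : y ≠ 0, Projectivization.mk ℂ y hy = p.1

theorem Represents.exists_smul {p : Curve} {x y : Fin 5 → ℂ} (hx : Represents p x)
    (hy : Represents p y) : ∃ a : ℂ, a ≠ 0 ∧ x = a • y := by
  obtain ⟨hx0, hx⟩ := hx
  obtain ⟨hy0, hy⟩ := hy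
  obtain ⟨a, ha⟩ := (Projectivization.mk_eq_mk_iff' ℂ x y hx0 hy0).mp (hx.trans hy.symm)
  refine ⟨a, ?_, ha.symm⟩
  rintro rfl
  exact hx0 (by rw [← ha, zero_smul])

theorem Represents.smul {p : Curve} {x : Fin 5 → ℂ} (hx : Represents p x) {a : ℂ} (ha : a ≠ 0) :
    Represents p (a • x) := by
  obtain ⟨hx0, hx⟩ := hx
  exact ⟨smul_ne_zero ha hx0, by
    rw [← hx, Projectivization.mk_eq_mk_iff' ℂ _ _ _ hx0]; exact ⟨a, rfl⟩⟩

theorem Represents.of_proportional {p : Curve} {x y : Fin 5 → ℂ} (hx : Represents p x)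
    (hy : y ≠ 0) (h : ∀ i l, x i * y l = x l * y i) : Represents p y := by
  obtain ⟨l, hl⟩ := Function.ne_iff.mp hx.1
  obtain ⟨l', hl'⟩ := Function.ne_iff.mp hy
  have hyl : y l ≠ 0 := fun h0 => by
    have := h l l'
    rw [h0, mul_zero] at this
    exact mul_ne_zero hl hl' this
  have : y = (y l / x l) • x := by
    funext i
    rw [Pi.smul_apply, smul_eq_mul, div_mul_eq_mul_div, eq_div_iff hl]
    linear_combination -h i l
  rw [this]
  exact hx.smul (div_ne_zero hyl hl)

theorem Represents.onCurve {p : Curve} {x : Fin 5 → ℂ} (hx : Represents p x) : OnCurve x := by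
  have hrep : Represents p p.1.rep := ⟨p.1.rep_nonzero, p.1.mk_rep⟩
  obtain ⟨a, -, rfl⟩ := hx.exists_smul hrep
  obtain ⟨e1, e2, e3⟩ := p.2
  refine ⟨?_, ?_, ?_⟩ <;> simp only [Pi.smul_apply, smul_eq_mul]
  · linear_combination a ^ 2 * e1
  · linear_combination a ^ 2 * e2
  · linear_combination a ^ 2 * e3

theorem exists_represents {x : Fin 5 → ℂ} (hx0 : x ≠ 0) (hx : OnCurve x) :
    ∃ p : Curve, Represents p x := by
  refine ⟨⟨Projectivization.mk ℂ x hx0, ?_⟩, hx0, rfl⟩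
  obtain ⟨a, ha⟩ := Projectivization.exists_smul_eq_mk_rep ℂ x hx0
  rw [← ha]
  obtain ⟨e1, e2, e3⟩ := hx
  have hu : ∀ i, (a • x) i = (a : ℂ) * x i := fun i => rfl
  refine ⟨?_, ?_, ?_⟩ <;> simp only [hu]
  · linear_combination (a : ℂ) ^ 2 * e1
  · linear_combination (a : ℂ) ^ 2 * e2
  · linear_combination (a : ℂ) ^ 2 * e3

/-- The sign of the `i`-th homogeneous coordinate of the vertex `v`. -/
def coordSign (i : Fin 5) (v : Vertex) : ℤ := ∏ l ∈ Finset.Iic (i + 3), bitSign (v l)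

theorem coordSign_flipAt (i j : Fin 5) (v : Vertex) :
    coordSign i (flipAt v j) = if j ≤ i + 3 then -coordSign i v else coordSign i v := by
  revert i j v; decide +kernel

theorem coordSign_sq (i : Fin 5) (v : Vertex) : coordSign i v ^ 2 = 1 := by
  revert i v; decide +kernel

/-- Homogeneous coordinates of the vertex `v`, if `c` are those of `(0,0,0,0,0)`. -/
noncomputable def vertexCoord (c : Fin 5 → ℂ) (v : Vertex) (i : Fin 5) : ℂ :=
  coordSign i v * c i * if IsWhite v then zeta ^ (9 * ((i + 3 : Fin 5) : ℕ)) else 1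

theorem vertexCoord_ne_zero {c : Fin 5 → ℂ} {i : Fin 5} (hc : c i ≠ 0) (v : Vertex) :
    vertexCoord c v i ≠ 0 := by
  have h1 : (coordSign i v : ℂ) ≠ 0 := by
    intro h
    have := coordSign_sq i v
    rw [Int.cast_eq_zero.mp h] at this
    norm_num at this
  refine mul_ne_zero (mul_ne_zero h1 hc) ?_
  split_ifs
  · exact pow_ne_zero _ zeta_ne_zero
  · exact one_ne_zero

/-- The common factor of the coordinates of the two ends of an edge of colour `j`. -/
noncomputable def edgeScale (j : Fin 5) : ℂ := zeta ^ (9 * (j : ℕ) + 3)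

theorem edgeScale_ne_zero (j : Fin 5) : edgeScale j ≠ 0 := pow_ne_zero _ zeta_ne_zero

/-- Along an edge of colour `j` the `i`-th coordinate is multiplied by `edgeRoot (j - i - 1)`. Up to
a common scalar, this is a factor independent of `j` times a sign that depends on whether `j ≤ i +
3`; flipping the corresponding bit produces exactly this sign in `coordSign`. -/
theorem edgeScale_mul_edgeRoot (i j : Fin 5) : edgeScale j * edgeRoot (j - i - 1) =
    (if j ≤ i + 3 then -1 else 1) * zeta ^ (9 * ((i + 3 : Fin 5) : ℕ)) := by
  have h : (if j ≤ i + 3 then -1 else 1 : ℂ) = zeta ^ (if j ≤ i + 3 then 5 else 0) := by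
    split_ifs <;> simp [zeta_pow_five]
  rw [h, edgeScale, edgeRoot, ← pow_add, ← pow_add]
  apply zeta_pow_congr
  clear h
  revert i j; decide

theorem vertexCoord_flipAt (c : Fin 5 → ℂ) {v : Vertex} (hv : ¬ IsWhite v) (i j : Fin 5) :
    vertexCoord c (flipAt v j) i = edgeScale j * (edgeRoot (j - i - 1) * vertexCoord c v i) := by
  have hw : IsWhite (flipAt v j) := (isWhite_flipAt v j).mpr hv
  rw [vertexCoord, vertexCoord, if_pos hw, if_neg hv, coordSign_flipAt, ← mul_assoc,
    edgeScale_mul_edgeRoot]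
  split_ifs <;> push_cast <;> ring

/-- Homogeneous coordinates of the centre of a face with colours `J, J + 1` and black corner `v`. -/
noncomputable def centerCoord (c : Fin 5 → ℂ) (J : Fin 5) (v : Vertex) (i : Fin 5) : ℂ :=
  if i = J + 2 then 0 else vertexCoord c v i * root (segmentTo (centerRatio (J + 2 - i)) (1 / 2))

theorem vertexCoord_fun_ne_zero {c : Fin 5 → ℂ} (hc : ∀ i, c i ≠ 0) (v : Vertex) :
    vertexCoord c v ≠ 0 := fun h => vertexCoord_ne_zero (hc 0) v (congrFun h 0)

theorem sub_ne_zero_of_ne {i J : Fin 5} (h : i ≠ J + 2) : J + 2 - i ≠ 0 :=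
  sub_ne_zero.mpr (Ne.symm h)

theorem centerCoord_ne_zero {c : Fin 5 → ℂ} {i J : Fin 5} (hc : c i ≠ 0) (v : Vertex)
    (h : i ≠ J + 2) : centerCoord c J v i ≠ 0 := by
  rw [centerCoord, if_neg h]
  refine mul_ne_zero (vertexCoord_ne_zero hc v) (root_ne_zero (Complex.slitPlane_ne_zero
    (segmentTo_mem (centerRatio_mem (sub_ne_zero_of_ne h)) ⟨by norm_num, by norm_num⟩)))

theorem centerCoord_fun_ne_zero {c : Fin 5 → ℂ} (hc : ∀ i, c i ≠ 0) (J : Fin 5) (v : Vertex) :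
    centerCoord c J v ≠ 0 := fun h =>
  centerCoord_ne_zero (i := J) (J := J) (hc J) v (by clear h; revert J; decide) (congrFun h J)

/-! ### The coordinates of an embedding -/

theorem vertex_induction {P : Vertex → Prop} (v : Vertex) (h0 : P v)
    (hs : ∀ u j, P u → P (flipAt u j)) : ∀ u, P u := by
  suffices H : ∀ (n : ℕ) (u : Vertex), hammingDist u v = n → P u from fun u => H _ u rfl
  intro n
  induction n with
  | zero =>
    intro u hu
    rwa [hammingDist_eq_zero.mp hu]
  | succ n ih =>
    intro u hu
    obtain ⟨j, hj⟩ : ∃ j, u j ≠ v j := by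
      by_contra! hne
      rw [funext hne, hammingDist_self] at hu
      omega
    rw [← flipAt_flipAt_self u j]
    exact hs _ _ (ih _ (by have := hammingDist_flipAt hj; omega))

theorem JoinedOver.edge_coord {j : Fin 5} {p q : Curve}
    (h : JoinedOver (zeta ^ (2 * (j : ℕ) + 2)) 0 1 p q) :
    ∃ x y : Fin 5 → ℂ, Represents p x ∧ Represents q y ∧ LiesOver x 0 1 ∧
      ∀ i l, y i * (x l * edgeRoot (j - l - 1)) = y l * (x i * edgeRoot (j - i - 1)) := by
  obtain ⟨x, hx, hc, hon, hp, hq⟩ := h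
  refine ⟨x 0, x 1, ⟨hx 0, hp⟩, ⟨hx 1, hq⟩, ?_, fun i l => ?_⟩
  · simpa using (hon 0 Set.left_mem_uIcc).2
  · have := path_unique (pow_ne_zero _ zeta_ne_zero) zero_le_one le_rfl hx hc hon
      (sq_mem_slitPlane (edgeRoot_re_pos (j - i - 1)))
      (sq_mem_slitPlane (edgeRoot_re_pos (j - l - 1)))
      (edge_direction i j) (edge_direction l j)
    rwa [segmentTo_one, segmentTo_one, root_of_sq (edgeRoot_re_pos _),
      root_of_sq (edgeRoot_re_pos _)] at this

namespace Embedding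

theorem represents_flipAt_iff (ε : Embedding) {c : Fin 5 → ℂ} (hc : ∀ i, c i ≠ 0) {v : Vertex}
    (hv : ¬ IsWhite v) (j : Fin 5) : Represents (ε.vertex (flipAt v j)) (vertexCoord c (flipAt v j)) ↔
      Represents (ε.vertex v) (vertexCoord c v) := by
  obtain ⟨x, y, hx, hy, -, hxy⟩ := (ε.edge v j hv).edge_coord
  constructor
  · intro h
    obtain ⟨a, ha, rfl⟩ := hy.exists_smul h
    refine hx.of_proportional (vertexCoord_fun_ne_zero hc v) fun i l => ?_
    have h1 := hxy i l
    simp only [Pi.smul_apply, smul_eq_mul, vertexCoord_flipAt c hv] at h1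
    have h2 : a * edgeScale j * edgeRoot (j - i - 1) * edgeRoot (j - l - 1) ≠ 0 :=
      mul_ne_zero (mul_ne_zero (mul_ne_zero ha (edgeScale_ne_zero j)) (edgeRoot_ne_zero _))
        (edgeRoot_ne_zero _)
    apply mul_left_cancel₀ h2
    linear_combination -h1
  · intro h
    obtain ⟨a, ha, rfl⟩ := hx.exists_smul h
    refine hy.of_proportional (vertexCoord_fun_ne_zero hc _) fun i l => ?_
    have h1 := hxy i l
    simp only [Pi.smul_apply, smul_eq_mul] at h1
    simp only [vertexCoord_flipAt c hv]
    apply mul_left_cancel₀ ha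
    linear_combination edgeScale j * h1

theorem represents_flipAt (ε : Embedding) {c : Fin 5 → ℂ} (hc : ∀ i, c i ≠ 0) (v : Vertex)
    (j : Fin 5) (h : Represents (ε.vertex v) (vertexCoord c v)) :
    Represents (ε.vertex (flipAt v j)) (vertexCoord c (flipAt v j)) := by
  by_cases hv : IsWhite v
  · have hw : ¬ IsWhite (flipAt v j) := by rw [isWhite_flipAt]; simpa using hv
    have := represents_flipAt_iff ε hc hw j
    rw [flipAt_flipAt_self] at this
    exact this.mp h
  · exact (represents_flipAt_iff ε hc hv j).mpr h

/-- The vertices of an embedding have the coordinates `vertexCoord c`. -/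
theorem exists_coord (ε : Embedding) : ∃ (c : Fin 5 → ℂ) (μ : ℂ), μ ≠ 0 ∧
    (∀ i, c i ^ 2 = μ * (lead i * -branch i)) ∧
    ∀ v, Represents (ε.vertex v) (vertexCoord c v) := by
  have h0 : ¬ IsWhite fun _ => false := by decide +kernel
  -- Any edge at the origin would do: it only supplies coordinates of that vertex and the fact that
  -- it lies over `0`.
  obtain ⟨c, -, hc, -, hl, -⟩ := (ε.edge _ 0 h0).edge_coord
  obtain ⟨μ, hμ⟩ := exists_sq_eq (Or.inr one_ne_zero) hc.onCurve hl
  simp only [mul_one, zero_sub] at hμ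
  have hμ0 : μ ≠ 0 := by
    rintro rfl
    obtain ⟨i, hi⟩ := Function.ne_iff.mp hc.1
    exact pow_ne_zero 2 hi (by rw [hμ, zero_mul])
  have hc0 : ∀ i, c i ≠ 0 := fun i h => by
    have h1 := hμ i
    rw [h, zero_pow two_ne_zero] at h1
    exact mul_ne_zero hμ0 (mul_ne_zero (lead_ne_zero i) (neg_ne_zero.mpr (branch_ne_zero i))) h1.symm
  refine ⟨c, μ, hμ0, hμ, vertex_induction (fun _ => false) ?_ (ε.represents_flipAt hc0)⟩
  have : vertexCoord c (fun _ => false) = c := by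
    funext i
    have h1 : coordSign i (fun _ => false) = 1 := by revert i; decide +kernel
    rw [vertexCoord, if_neg h0, h1]; simp
  rwa [this]

theorem represents_center (ε : Embedding) {c : Fin 5 → ℂ} (hc : ∀ i, c i ≠ 0) (f : Face)
    (i : Fin 4) (hv : ¬ IsWhite (corner f i))
    (h : Represents (ε.vertex (corner f i)) (vertexCoord c (corner f i))) :
    Represents (ε.center f) (centerCoord c f.1.1 (corner f i)) := by
  obtain ⟨x, hx, hcont, hon, hp, hq⟩ := ε.center_black f i hv
  set v := corner f i
  set J := f.1.1
  have hd : zeta ^ (2 * (J : ℕ) + 3) ≠ 0 := pow_ne_zero _ zeta_ne_zero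
  obtain ⟨a, ha, hxa⟩ := Represents.exists_smul ⟨hx 0, hp⟩ h
  have hzero : x (1 / 2) (J + 2) = 0 := by
    have h1 := hon (1 / 2) Set.right_mem_uIcc
    have hn : ((1 / 2 : ℝ) : ℂ) ≠ 0 := by norm_num
    obtain ⟨μ, hμ⟩ := exists_sq_eq (Or.inl (mul_ne_zero hn hd)) h1.1 h1.2
    have h2 := hμ (J + 2)
    rw [sub_branch_eq (center_direction (J + 2) J), sub_self] at h2
    have : segmentTo (centerRatio 0) (1 / 2) = 0 := by
      rw [centerRatio_zero, segmentTo]; norm_num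
    rw [this] at h2
    exact pow_eq_zero_iff two_ne_zero |>.mp (h2.trans (by ring))
  refine Represents.of_proportional ⟨hx _, hq⟩ (centerCoord_fun_ne_zero hc J v) fun i l => ?_
  by_cases hi : i = J + 2
  · rw [hi, hzero, centerCoord.eq_def c J v (J + 2), if_pos rfl]; ring
  by_cases hl : l = J + 2
  · rw [hl, hzero, centerCoord.eq_def c J v (J + 2), if_pos rfl]; ring
  have h1 := path_unique hd (by norm_num) (by norm_num) hx hcont hon
    (centerRatio_mem (sub_ne_zero_of_ne hi)) (centerRatio_mem (sub_ne_zero_of_ne hl))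
    (center_direction i J) (center_direction l J)
  rw [hxa] at h1
  simp only [Pi.smul_apply, smul_eq_mul] at h1
  rw [centerCoord, centerCoord, if_neg hi, if_neg hl]
  apply mul_left_cancel₀ ha
  linear_combination h1

end Embedding

/-! ### The maps to the elliptic curves in homogeneous coordinates -/

/-- The coordinate `X` of the map to `E k` is a multiple of `x (k + 1) ^ 2 / x (k - 1) ^ 2`. -/
noncomputable def nuScale : Fin 5 → ℂ := ![-1, -1, phi, 1 - phi, 1]

theorem nuX_eq {k : Fin 5} {x : Fin 5 → ℂ} (hx : OnCurve x) (hk : x (k - 1) ≠ 0) :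
    nuX k x = lam k * (nuScale k * x (k + 1) ^ 2 / x (k - 1) ^ 2) + off k := by
  obtain ⟨e1, e2, e3⟩ := hx
  have h := phi_sq
  fin_cases k
  · change x 4 ≠ 0 at hk
    change -(2 * phi + 1) * (x 0 ^ 2 / x 4 ^ 2) - phi = -phi * (-1 * x 1 ^ 2 / x 4 ^ 2) + 0
    field_simp
    linear_combination -phi * e3 + x 0 ^ 2 * h
  · change x 0 ≠ 0 at hk
    change x 1 ^ 2 / x 0 ^ 2 + phi + 1 = 1 * (-1 * x 2 ^ 2 / x 0 ^ 2) + phi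
    field_simp
    linear_combination e1
  · change x 1 ≠ 0 at hk
    change (2 * phi + 1) * (x 2 ^ 2 / x 1 ^ 2) + phi + 1 = phi * (phi * x 3 ^ 2 / x 1 ^ 2) + 1
    field_simp
    linear_combination (2 * phi + 1) * e1 - (phi + 1) * e2 + x 0 ^ 2 * h - x 3 ^ 2 * h
  · change x 2 ≠ 0 at hk
    change (phi + 1) * (x 3 ^ 2 / x 2 ^ 2) - phi = -phi * ((1 - phi) * x 4 ^ 2 / x 2 ^ 2) + 0
    field_simp
    linear_combination (phi + 1) * e2 - phi * e1 - e3 - x 0 ^ 2 * h - x 4 ^ 2 * h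
  · change x 3 ≠ 0 at hk
    change -(x 4 ^ 2 / x 3 ^ 2) + phi + 1 = 1 * (1 * x 0 ^ 2 / x 3 ^ 2) + phi
    field_simp
    linear_combination e2 - e3

/-- The second coordinate is a monomial without `x k`. All vertices can therefore be compared with
the origin by rescaling each coordinate separately. -/
theorem nuY_mul (k : Fin 5) (w x : Fin 5 → ℂ) : nuY k (fun i => w i * x i) =
    w (k + 1) * w (k + 2) * w (k + 3) / w (k - 1) ^ 3 * nuY k x := by
  have key : ∀ m a b c d a' b' c' d' : ℂ, m * ((a * a') * (b * b') * (c * c') / (d * d') ^ 3) =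
      a * b * c / d ^ 3 * (m * (a' * b' * c' / d' ^ 3)) := by
    intros; rw [mul_pow]; ring
  fin_cases k
  · exact key (2 * phi + 1) _ _ _ _ _ _ _ _
  · exact key Complex.I _ _ _ _ _ _ _ _
  · change Complex.I * (2 * phi + 1) * (w 0 * x 0 * (w 3 * x 3) * (w 4 * x 4) / (w 1 * x 1) ^ 3) =
      w 3 * w 4 * w 0 / w 1 ^ 3 * (Complex.I * (2 * phi + 1) * (x 0 * x 3 * x 4 / x 1 ^ 3))
    rw [key]; ring
  · change Complex.I * phi * (w 0 * x 0 * (w 1 * x 1) * (w 4 * x 4) / (w 2 * x 2) ^ 3) =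
      w 4 * w 0 * w 1 / w 2 ^ 3 * (Complex.I * phi * (x 0 * x 1 * x 4 / x 2 ^ 3))
    rw [key]; ring
  · exact key Complex.I _ _ _ _ _ _ _ _

theorem nuScale_mul_lead (k : Fin 5) : nuScale k * lead (k + 1) = zeta ^ 3 * lead (k - 1) := by
  have h := zeta_cyclotomic
  have h' := phi_eq'
  fin_cases k
  · change -1 * (zeta ^ 3 + zeta ^ 4) = zeta ^ 3 * -(1 + zeta)
    ring
  · change -1 * -(zeta + zeta ^ 4) = zeta ^ 3 * (zeta - zeta ^ 3)
    grind
  · change phi * -(1 + zeta ^ 3) = zeta ^ 3 * (zeta ^ 3 + zeta ^ 4)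
    grind
  · change (1 - phi) * -(1 + zeta) = zeta ^ 3 * -(zeta + zeta ^ 4)
    grind
  · change 1 * (zeta - zeta ^ 3) = zeta ^ 3 * -(1 + zeta ^ 3)
    grind

theorem branch_add_one (k : Fin 5) : branch (k + 1) = zeta ^ 4 * branch (k - 1) := by
  rw [branch, branch, ← pow_add]
  apply zeta_pow_congr
  revert k; decide

theorem root_conj {z : ℂ} (hz : z ∈ Complex.slitPlane) :
    root ((starRingEnd ℂ) z) = (starRingEnd ℂ) (root z) := by
  have := Complex.conj_cpow z (2⁻¹) (Complex.slitPlane_arg_ne_pi hz)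
  simpa [root, Complex.conj_ofNat] using this

theorem root_mul_root_conj {z : ℂ} (hz : z ∈ Complex.slitPlane) :
    ∃ p : ℝ, 0 < p ∧ root z * root ((starRingEnd ℂ) z) = p :=
  ⟨Complex.normSq (root z), Complex.normSq_pos.mpr (root_ne_zero (Complex.slitPlane_ne_zero hz)),
    by rw [root_conj hz, Complex.mul_conj]⟩

/-- The factor of the `i`-th coordinate along the path from a black vertex to a face centre. -/
noncomputable def centerFactor (m : Fin 5) : ℂ := root (segmentTo (centerRatio m) (1 / 2))

theorem centerFactor_sq (m : Fin 5) : centerFactor m ^ 2 = (1 + centerRatio m) / 2 := by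
  rw [centerFactor, root_sq, segmentTo]
  push_cast; ring

theorem star_segmentTo (z : ℂ) (s : ℝ) :
    (starRingEnd ℂ) (segmentTo z s) = segmentTo ((starRingEnd ℂ) z) s := by
  simp [segmentTo]

theorem star_zeta_pow (m : ℕ) : (starRingEnd ℂ) (zeta ^ m) = zeta ^ (9 * m) := by
  rw [map_pow, star_zeta, neg_zeta_pow, ← pow_mul]

/-- The factors form two complex conjugate pairs, so the product is positive. Its square is `5 /
16`, and positivity selects the root `√5 / 4`. -/
theorem centerFactor_prod :
    centerFactor 4 * centerFactor 3 * centerFactor 2 * centerFactor 1 = (2 * phi - 1) / 4 := by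
  have hmem : ∀ {m : Fin 5}, m ≠ 0 → segmentTo (centerRatio m) (1 / 2) ∈ Complex.slitPlane :=
    fun hm => segmentTo_mem (centerRatio_mem hm) ⟨by norm_num, by norm_num⟩
  have h1 : centerRatio 1 = (starRingEnd ℂ) (centerRatio 4) := by
    simp only [centerRatio, star_zeta_pow]
    exact zeta_pow_congr (by decide)
  have h2 : centerRatio 2 = (starRingEnd ℂ) (centerRatio 3) := by
    simp only [centerRatio, star_zeta_pow]
    exact zeta_pow_congr (by decide)
  obtain ⟨p, hp, e1⟩ := root_mul_root_conj (hmem (m := 4) (by decide))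
  obtain ⟨q, hq, e2⟩ := root_mul_root_conj (hmem (m := 3) (by decide))
  rw [star_segmentTo, ← h1] at e1
  rw [star_segmentTo, ← h2] at e2
  have e3 : centerFactor 4 * centerFactor 3 * centerFactor 2 * centerFactor 1 = (p * q : ℝ) := by
    push_cast
    rw [← e1, ← e2]
    simp only [centerFactor]; ring
  have e4 : (2 * phi - 1) / 4 = (((2 * Real.goldenRatio - 1) / 4 : ℝ) : ℂ) := by
    simp [phi]
  rw [e3, e4]
  congr 1
  have hg : 0 ≤ (2 * Real.goldenRatio - 1) / 4 := by
    have := Real.one_lt_goldenRatio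
    linarith
  refine (pow_left_inj₀ (by positivity) hg two_ne_zero).mp ?_
  have : ((p * q : ℝ) : ℂ) ^ 2 = (((2 * Real.goldenRatio - 1) / 4 : ℝ) : ℂ) ^ 2 := by
    rw [← e3, ← e4]
    simp only [mul_pow, centerFactor_sq]
    have h := zeta_cyclotomic
    have h5 := zeta_pow_five
    rw [phi_eq']
    simp only [centerRatio, Matrix.cons_val]
    grind
  exact_mod_cast this

theorem centerFactor_prod_div :
    centerFactor 4 * centerFactor 3 * centerFactor 2 / centerFactor 1 ^ 3 = phi * zeta ^ 3 := by
  have h1 : centerFactor 1 ≠ 0 := root_ne_zero (Complex.slitPlane_ne_zero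
    (segmentTo_mem (centerRatio_mem (by decide)) ⟨by norm_num, by norm_num⟩))
  rw [div_eq_iff (pow_ne_zero _ h1)]
  apply mul_right_cancel₀ h1
  rw [centerFactor_prod]
  have : centerFactor 1 ^ 3 * centerFactor 1 = ((1 + zeta ^ 7) / 2) ^ 2 := by
    rw [show (1 + zeta ^ 7) / 2 = centerFactor 1 ^ 2 from (centerFactor_sq 1).symm]; ring
  rw [mul_assoc, this]
  have h := zeta_cyclotomic
  have h5 := zeta_pow_five
  rw [phi_eq']
  grind

/-! ### The images of the vertices and the centres -/

theorem nu_of_represents {k : Fin 5} {p : Curve} {x : Fin 5 → ℂ} (hp : Represents p x)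
    (hk : x (k - 1) ≠ 0) : nu k p = .some _ _ (nu_nonsingular k x hp.onCurve hk) := by
  rw [nu_eq k p x hp.1 hp.onCurve hp.2, dif_neg hk]

theorem nu_of_represents_zero {k : Fin 5} {p : Curve} {x : Fin 5 → ℂ} (hp : Represents p x)
    (hk : x (k - 1) = 0) : nu k p = 0 := by
  rw [nu_eq k p x hp.1 hp.onCurve hp.2, dif_pos hk]

theorem nonsingular_sign_mul {k : Fin 5} {x y : ℂ} {t : ℤ} (ht : |t| = 1)
    (h : (E k).Nonsingular x y) : (E k).Nonsingular x (t * y) := by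
  rcases (abs_eq zero_le_one).mp ht with rfl | rfl
  · simpa using h
  · have := (nonsingular_neg x y).mpr h
    rw [negY_eq] at this
    simpa using this

theorem sign_smul_some {k : Fin 5} {x y : ℂ} {t : ℤ} (ht : |t| = 1) (h : (E k).Nonsingular x y) :
    t • Point.some x y h = Point.some x (t * y) (nonsingular_sign_mul ht h) := by
  rcases (abs_eq zero_le_one).mp ht with rfl | rfl
  · rw [one_smul]
    exact some_congr rfl (by simp)
  · rw [neg_one_smul, neg_some_eq h (by simpa using nonsingular_sign_mul ht h)]
    exact some_congr rfl (by simp)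

theorem nuX_of_sq {k : Fin 5} {x : Fin 5 → ℂ} {μ a b : ℂ} (hμ : μ ≠ 0) (hx : OnCurve x)
    (hk : x (k - 1) ≠ 0) (ha : x (k + 1) ^ 2 = μ * (lead (k + 1) * -branch (k + 1)) * a)
    (hb : x (k - 1) ^ 2 = μ * (lead (k - 1) * -branch (k - 1)) * b) :
    nuX k x = lam k * (zeta ^ 7 * (a / b)) + off k := by
  have hb0 : b ≠ 0 := by
    rintro rfl
    exact pow_ne_zero 2 hk (by rw [hb, mul_zero])
  have h1 := lead_ne_zero (k - 1)
  have h2 := branch_ne_zero (k - 1)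
  rw [nuX_eq hx hk, ha, hb, branch_add_one]
  congr 2
  rw [div_eq_iff (mul_ne_zero (mul_ne_zero hμ (mul_ne_zero h1 (neg_ne_zero.mpr h2))) hb0)]
  field_simp
  linear_combination -(zeta ^ 4 * a) * nuScale_mul_lead k

/-- The signs of the coordinates are partial products of bit signs, and their product leaves
`faceSign`. The power of `-1` at white vertices is absorbed by the powers of `ζ` in `vertexCoord`.
-/
theorem coordSign_prod (k : Fin 5) (v : Vertex) :
    coordSign (k + 1) v * coordSign (k + 2) v * coordSign (k + 3) v * coordSign (k - 1) v =
      faceSign (k + 3) v * if IsWhite v then (-1) ^ ((k + 3 : Fin 5) : ℕ) else 1 := by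
  revert k v; decide +kernel

theorem coordSign_prod_div (k : Fin 5) (v : Vertex) :
    (coordSign (k + 1) v * coordSign (k + 2) v * coordSign (k + 3) v / coordSign (k - 1) v ^ 3 : ℂ) =
      faceSign (k + 3) v * if IsWhite v then (-1) ^ ((k + 3 : Fin 5) : ℕ) else 1 := by
  have h1 : (coordSign (k - 1) v : ℂ) ^ 2 = 1 := by exact_mod_cast coordSign_sq (k - 1) v
  have h2 := congrArg (Int.cast : ℤ → ℂ) (coordSign_prod k v)
  push_cast at h2
  rw [← h2, div_eq_iff (by
    intro h
    rw [pow_succ, h1, one_mul] at h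
    rw [h] at h1
    norm_num at h1)]
  linear_combination (-(coordSign (k - 1) v : ℂ) ^ 2 - 1) *
    (coordSign (k + 1) v * coordSign (k + 2) v * coordSign (k + 3) v) * h1

theorem coordSign_sq' (i : Fin 5) (v : Vertex) : (coordSign i v : ℂ) ^ 2 = 1 := by
  exact_mod_cast coordSign_sq i v

section Values

variable {c : Fin 5 → ℂ} {μ : ℂ}

theorem coord_ne_zero (hμ : μ ≠ 0) (hc : ∀ i, c i ^ 2 = μ * (lead i * -branch i))
    (i : Fin 5) : c i ≠ 0 := fun h => by
  have h1 := hc i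
  rw [h, zero_pow two_ne_zero] at h1
  exact mul_ne_zero hμ (mul_ne_zero (lead_ne_zero i) (neg_ne_zero.mpr (branch_ne_zero i))) h1.symm

theorem onCurve_coord (hc : ∀ i, c i ^ 2 = μ * (lead i * -branch i)) : OnCurve c :=
  onCurve_of_sq_eq (a := 0) (b := 1) (μ := μ) fun i => by rw [hc]; ring

theorem nuX_coord (hμ : μ ≠ 0) (hc : ∀ i, c i ^ 2 = μ * (lead i * -branch i))
    (k : Fin 5) : nuX k c = lam k * -zeta ^ 2 + off k := by
  rw [nuX_of_sq (a := 1) (b := 1) hμ (onCurve_coord hc) (coord_ne_zero hμ hc _)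
    (by rw [hc, mul_one]) (by rw [hc, mul_one])]
  linear_combination lam k * zeta ^ 2 * zeta_pow_five

/-- The factor `ζ ^ 8` normalises the second coordinate at the origin to the form `s * ζ ^ 2`. This
fixes the root `s`, and so the sign of the generator, for a given embedding. -/
theorem nuY_coord_sq (hμ : μ ≠ 0) (hc : ∀ i, c i ^ 2 = μ * (lead i * -branch i))
    (k : Fin 5) : (nuY k c * zeta ^ 8) ^ 2 = lam k ^ 3 * phi := by
  have h := nu_equation k c (onCurve_coord hc) (coord_ne_zero hμ hc _)
  rw [nuX_coord hμ hc, equation_scaled] at h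
  have h2 := zeta_cyclotomic
  have h5 := zeta_pow_five
  have h3 : -zeta ^ 2 * ((-zeta ^ 2) ^ 2 + (2 * phi - 1) * -zeta ^ 2 + 1) * zeta ^ 16 = phi := by
    rw [phi_eq']; grind
  rw [mul_pow, h]
  linear_combination lam k ^ 3 * h3

theorem nu_vertex (hμ : μ ≠ 0) (hc : ∀ i, c i ^ 2 = μ * (lead i * -branch i))
    (k : Fin 5) {p : Curve} {v : Vertex} (hp : Represents p (vertexCoord c v)) :
    nu k p = faceSign (k + 3) v •
      if IsWhite v then whitePoint (nuY_coord_sq hμ hc k) else blackPoint (nuY_coord_sq hμ hc k) := by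
  have h0 := vertexCoord_ne_zero (coord_ne_zero hμ hc (k - 1)) v
  rw [nu_of_represents hp h0]
  have hw : vertexCoord c v = fun i => (coordSign i v *
      if IsWhite v then zeta ^ (9 * ((i + 3 : Fin 5) : ℕ)) else 1) * c i := by
    funext i; rw [vertexCoord]; ring
  have hY : nuY k (vertexCoord c v) = _ := hw ▸ nuY_mul k _ c
  have hsq : ∀ i, vertexCoord c v i ^ 2 = μ * (lead i * -branch i) *
      (if IsWhite v then zeta ^ (9 * ((i + 3 : Fin 5) : ℕ)) else 1) ^ 2 := by
    intro i
    rw [vertexCoord, mul_pow, mul_pow, coordSign_sq', one_mul, hc]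
  have hX := nuX_of_sq hμ hp.onCurve h0 (hsq _) (hsq _)
  have hsign := coordSign_prod_div k v
  by_cases hv : IsWhite v
  · simp only [if_pos hv] at *
    rw [whitePoint, sign_smul_some (abs_faceSign _ _)]
    · apply some_congr
      · rw [hX]
        have : zeta ^ 7 * ((zeta ^ (9 * ((k + 1 + 3 : Fin 5) : ℕ))) ^ 2 /
            (zeta ^ (9 * ((k - 1 + 3 : Fin 5) : ℕ))) ^ 2) = zeta ^ 3 := by
          rw [mul_div_assoc', div_eq_iff (pow_ne_zero _ (pow_ne_zero _ zeta_ne_zero)), ← pow_mul,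
            ← pow_mul, ← pow_add, ← pow_add]
          apply zeta_pow_congr
          clear * -
          revert k; decide
        rw [this]
      · rw [hY]
        have e : (-1 : ℂ) ^ ((k + 3 : Fin 5) : ℕ) * (zeta ^ (9 * ((k + 1 + 3 : Fin 5) : ℕ)) *
            zeta ^ (9 * ((k + 2 + 3 : Fin 5) : ℕ)) * zeta ^ (9 * ((k + 3 + 3 : Fin 5) : ℕ)) /
            (zeta ^ (9 * ((k - 1 + 3 : Fin 5) : ℕ))) ^ 3) = -zeta ^ 11 := by
          rw [mul_div_assoc', div_eq_iff (pow_ne_zero _ (pow_ne_zero _ zeta_ne_zero)),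
            ← zeta_pow_five, neg_zeta_pow, ← pow_mul, ← pow_mul, ← pow_add, ← pow_add, ← pow_add,
            ← pow_add]
          apply zeta_pow_congr
          clear * -
          revert k; decide
        have e2 : ∀ a b d g a' b' d' g' : ℂ, a * a' * (b * b') * (d * d') / (g * g') ^ 3 =
            (a * b * d / g ^ 3) * (a' * b' * d' / g' ^ 3) := by
          intros; rw [mul_pow, div_mul_div_comm]; ring
        rw [e2, hsign]
        linear_combination faceSign (k + 3) v * nuY k c * e
  · simp only [if_neg hv] at *
    rw [blackPoint, sign_smul_some (abs_faceSign _ _)]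
    · apply some_congr
      · rw [hX]
        linear_combination lam k * zeta ^ 2 * zeta_pow_five
      · rw [hY]
        simp only [mul_one] at hsign ⊢
        rw [hsign]
        linear_combination -(faceSign (k + 3) v : ℂ) * nuY k c * (zeta ^ 5 - 1) * zeta_pow_five

theorem vertexCoord_of_black {v : Vertex} (hv : ¬ IsWhite v) (i : Fin 5) :
    vertexCoord c v i = coordSign i v * c i := by
  rw [vertexCoord, if_neg hv, mul_one]

theorem centerCoord_sq (hc : ∀ i, c i ^ 2 = μ * (lead i * -branch i)) {J : Fin 5} {v : Vertex}
    (hv : ¬ IsWhite v) (i : Fin 5) : centerCoord c J v i ^ 2 =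
      μ * (lead i * -branch i) * ((1 + centerRatio (J + 2 - i)) / 2) := by
  rw [centerCoord]
  split_ifs with h
  · rw [h, sub_self, centerRatio_zero]; ring
  · rw [mul_pow, vertexCoord_of_black hv, mul_pow, coordSign_sq', one_mul, hc, root_sq, segmentTo]
    push_cast; ring

theorem nu_center_of_eq (hμ : μ ≠ 0) (hc : ∀ i, c i ^ 2 = μ * (lead i * -branch i))
    (k : Fin 5) {p : Curve} {v : Vertex} (hv : ¬ IsWhite v)
    (hp : Represents p (centerCoord c (k + 3) v)) :
    nu k p = faceSign (k + 3) v • centerPoint (nuY_coord_sq hμ hc k) := by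
  have hk3 : k + 3 + 2 = k := by clear * -; revert k; decide
  have hne : ∀ i : Fin 5, i ≠ 0 → k + i ≠ k := fun i hi h => hi (by simpa using h)
  have hne' : k - 1 ≠ k := by clear * -; revert k; decide
  have hk : centerCoord c (k + 3) v (k - 1) ≠ 0 := by
    refine centerCoord_ne_zero (coord_ne_zero hμ hc _) v ?_
    rw [hk3]
    exact hne'
  rw [nu_of_represents hp hk, centerPoint, sign_smul_some (abs_faceSign _ _)]
  apply some_congr
  · rw [nuX_of_sq hμ hp.onCurve hk (centerCoord_sq hc hv _) (centerCoord_sq hc hv _), hk3,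
      sub_sub_cancel, show k - (k + 1) = 4 by (clear * -; revert k; decide)]
    have h1 : 1 + zeta ^ 7 ≠ 0 := by
      have := centerCoord_sq hc hv (J := k + 3) (k - 1)
      rw [hk3, sub_sub_cancel] at this
      intro h
      apply pow_ne_zero 2 hk
      rw [this, show 1 + centerRatio 1 = 0 from h]; ring
    -- This is the value `X = 1` at the centre.
    have h2 : zeta ^ 7 * ((1 + centerRatio 4) / 2 / ((1 + centerRatio 1) / 2)) = 1 := by
      change zeta ^ 7 * ((1 + zeta ^ 3) / 2 / ((1 + zeta ^ 7) / 2)) = 1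
      field_simp
      linear_combination (zeta ^ 5 - 1) * zeta_pow_five
    rw [h2]
  · have hw : centerCoord c (k + 3) v = fun i => (coordSign i v *
        if i = k then 0 else centerFactor (k - i)) * c i := by
      funext i
      rw [centerCoord, hk3, vertexCoord_of_black hv, centerFactor]
      split_ifs <;> ring
    have hY : nuY k (centerCoord c (k + 3) v) = _ := hw ▸ nuY_mul k _ c
    have hsign := coordSign_prod_div k v
    simp only [if_neg hv, mul_one] at hsign
    simp only [if_neg (hne 1 (by decide)), if_neg (hne 2 (by decide)), if_neg (hne 3 (by decide)),
      if_neg hne', sub_sub_cancel,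
      show k - (k + 1) = 4 by (clear * -; revert k; decide),
      show k - (k + 2) = 3 by (clear * -; revert k; decide),
      show k - (k + 3) = 2 by (clear * -; revert k; decide)] at hY
    have e2 : ∀ a b d g a' b' d' g' : ℂ, a * a' * (b * b') * (d * d') / (g * g') ^ 3 =
        (a * b * d / g ^ 3) * (a' * b' * d' / g' ^ 3) := by
      intros; rw [mul_pow, div_mul_div_comm]; ring
    rw [hY, e2, hsign, centerFactor_prod_div]
    linear_combination phi * zeta ^ 3 * faceSign (k + 3) v * nuY k c * zeta_pow_five

theorem torsion_form {k : Fin 5} {X : ℂ} (hX : X * (X ^ 2 + (2 * phi - 1) * X + 1) = 0) :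
    (E k).Nonsingular (lam k * X + off k) 0 :=
  nonsingular_scaled (by rw [hX]; ring)

theorem torsion_one_sub_phi : (1 - phi) * ((1 - phi) ^ 2 + (2 * phi - 1) * (1 - phi) + 1) = 0 := by
  linear_combination (phi - 1) * phi_sq

theorem torsion_neg_phi : -phi * ((-phi) ^ 2 + (2 * phi - 1) * -phi + 1) = 0 := by
  linear_combination phi * phi_sq

/-- The image of the face centres with `x (k + n) = 0`, a point of order at most two. -/
noncomputable def torsionPoint (k n : Fin 5) : (E k).Point :=
  if n = 1 then offPoint k else
  if n = 2 then .some _ _ (torsion_form torsion_one_sub_phi) else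
  if n = 3 then .some _ _ (torsion_form torsion_neg_phi) else 0

theorem two_smul_torsionPoint (k n : Fin 5) : (2 : ℤ) • torsionPoint k n = 0 := by
  have h : ∀ {x : ℂ} (h : (E k).Nonsingular x 0), (2 : ℤ) • Point.some x 0 h = 0 := by
    intro x h
    have h1 := neg_some_eq h (by simpa using h)
    rw [some_congr rfl neg_zero] at h1
    rw [two_zsmul]
    nth_rewrite 1 [← h1]
    exact neg_add_cancel _
  unfold torsionPoint
  split_ifs
  · exact h _
  · exact h _
  · exact h _
  · exact zsmul_zero 2

/-- The three points with `y = 0` lie on a line; the fourth term is the point at infinity. -/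
theorem sum_torsionPoint (k : Fin 5) :
    torsionPoint k 1 + torsionPoint k 2 + torsionPoint k 3 + torsionPoint k 4 = 0 := by
  have h1 : torsionPoint k 2 + torsionPoint k 3 = torsionPoint k 1 := by
    have hl := lam_ne_zero k
    refine add_some_of_X_ne (l := 0) _ _ _ ?_ ?_ ?_ ?_
    · intro h
      exact hl (by linear_combination h)
    · ring
    · rw [one_add_r]; ring
    · ring
  have h4 : torsionPoint k 4 = 0 := rfl
  rw [add_assoc (torsionPoint k 1), h1, h4, add_zero, ← two_zsmul, two_smul_torsionPoint]

theorem nu_center_of_ne (hμ : μ ≠ 0) (hc : ∀ i, c i ^ 2 = μ * (lead i * -branch i))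
    (k : Fin 5) {J : Fin 5} (hJ : J ≠ k + 3) {p : Curve} {v : Vertex} (hv : ¬ IsWhite v)
    (hp : Represents p (centerCoord c J v)) : nu k p = torsionPoint k (J + 2 - k) := by
  obtain ⟨n, rfl⟩ : ∃ n, J = k + 3 + n := ⟨J - (k + 3), by abel⟩
  have hn : n ≠ 0 := by simpa using hJ
  have e : k + 3 + n + 2 = k + n := by clear * -; revert k n; decide
  have hz : centerCoord c (k + 3 + n) v (k + n) = 0 := by
    rw [centerCoord, if_pos e.symm]
  rw [e, add_sub_cancel_left]
  by_cases h4 : n = 4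
  · subst h4
    refine nu_of_represents_zero hp ?_
    rwa [show k - 1 = k + 4 by (clear * -; revert k; decide)]
  have hk : centerCoord c (k + 3 + n) v (k - 1) ≠ 0 := by
    refine centerCoord_ne_zero (coord_ne_zero hμ hc _) v ?_
    rw [e]
    clear * - h4
    revert k n; decide
  rw [nu_of_represents hp hk]
  -- The vanishing coordinate `x (k + n)`, with `n = 1, 2, 3`, is a factor of the numerator.
  have hY : nuY k (centerCoord c (k + 3 + n) v) = 0 := by
    have hw : centerCoord c (k + 3 + n) v =
        fun i => (if i = k + n then 0 else 1) * centerCoord c (k + 3 + n) v i := by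
      funext i
      split_ifs with h
      · rw [h, hz, mul_zero]
      · rw [one_mul]
    rw [hw, nuY_mul]
    fin_cases n
    · exact absurd rfl hn
    · simp
    · simp
    · simp
    · exact absurd rfl h4
  have hX := nuX_of_sq hμ hp.onCurve hk (centerCoord_sq hc hv _) (centerCoord_sq hc hv _)
  have h1 : k + n - (k + 1) = n - 1 := by abel
  have h2 : k + n - (k - 1) = n + 1 := by abel
  rw [e, h1, h2] at hX
  have h0 : 1 + centerRatio (n + 1) ≠ 0 := by
    have := centerCoord_sq hc hv (J := k + 3 + n) (k - 1)
    rw [e, h2] at this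
    intro h
    apply pow_ne_zero 2 hk
    rw [this, h]; ring
  have key : ∀ X, zeta ^ 7 * (1 + centerRatio (n - 1)) = X * (1 + centerRatio (n + 1)) →
      nuX k (centerCoord c (k + 3 + n) v) = lam k * X + off k := by
    intro X h
    rw [hX, div_div_div_cancel_right₀ two_ne_zero, mul_div_assoc', h, mul_div_cancel_right₀ _ h0]
  have hcyc := zeta_cyclotomic
  have hphi := phi_eq'
  have h5 := zeta_pow_five
  fin_cases n
  · exact absurd rfl hn
  · exact some_congr (key 0 (by
      change zeta ^ 7 * (1 + zeta ^ 5) = 0 * (1 + zeta ^ 9); grind)) hY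
  · exact some_congr (key (1 - phi) (by
      change zeta ^ 7 * (1 + zeta ^ 7) = (1 - phi) * (1 + zeta ^ 1); grind)) hY
  · exact some_congr (key (-phi) (by
      change zeta ^ 7 * (1 + zeta ^ 9) = -phi * (1 + zeta ^ 3); grind)) hY
  · exact absurd rfl h4

end Values

/-! ### The image of the divisor of a height function -/

theorem sum_zsmul_eq {ι M : Type*} [AddCommGroup M] (s : Finset ι) (f : ι → ℤ) (x : M) :
    (∑ i ∈ s, f i) • x = ∑ i ∈ s, f i • x := Finset.sum_smul

theorem zsmul_zsmul_add {M : Type*} [AddCommGroup M] (a b c : ℤ) (x y : M) :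
    a • (b • (x + c • y)) = (b * a) • x + (c * b * a) • y := by module

theorem nuHeight_eq_sum (ε : Embedding) (h : Height) (k : Fin 5) : nuHeight ε h k =
    ∑ v, vertexCoeff h v • nu k (ε.vertex v) + ∑ f, faceCoeff h f • nu k (ε.center f) := by
  have h0 : ∀ p : Curve, (0 : ℤ) • nu k p = 0 := fun p => zero_zsmul _
  have hadd : ∀ (p : Curve) (m n : ℤ), (m + n) • nu k p = m • nu k p + n • nu k p :=
    fun p m n => add_zsmul _ _ _
  rw [nuHeight, morseDivisor, Finsupp.sum_add_index' h0 hadd,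
    ← Finsupp.sum_finsetSum_index h0 hadd, ← Finsupp.sum_finsetSum_index h0 hadd]
  congr 1 <;> exact Finset.sum_congr rfl fun _ _ => Finsupp.sum_single_index (h0 _)

theorem exists_black_corner (f : Face) : ∃ i, ¬ IsWhite (corner f i) := by
  by_cases h : IsWhite f.1.2
  · exact ⟨1, fun h' => (isWhite_flipAt f.1.2 f.1.1).mp h' h⟩
  · exact ⟨0, h⟩

theorem nu_center (ε : Embedding) {c : Fin 5 → ℂ} {μ : ℂ} (hμ : μ ≠ 0)
    (hc : ∀ i, c i ^ 2 = μ * (lead i * -branch i))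
    (hv : ∀ v, Represents (ε.vertex v) (vertexCoord c v)) (k : Fin 5) (f : Face) :
    nu k (ε.center f) = if f.1.1 = k + 3 then
        faceSign (k + 3) f.1.2 • centerPoint (nuY_coord_sq hμ hc k)
      else torsionPoint k (f.1.1 + 2 - k) := by
  obtain ⟨i, hi⟩ := exists_black_corner f
  have hp := ε.represents_center (coord_ne_zero hμ hc) f i hi (hv _)
  split_ifs with hJ
  · have hs := faceSign_corner f i
    rw [hJ] at hp hs
    rw [nu_center_of_eq hμ hc k hi hp, hs]
  · exact nu_center_of_ne hμ hc k hJ hi hp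

/-- All numbers of bow ties have the same parity, so they may be replaced by one of them, and the
points of order at most two sum to zero. -/
theorem sum_bowTies_smul_torsionPoint (h : Height) (k : Fin 5) :
    ∑ j with j ≠ k + 3, bowTies h j • torsionPoint k (j + 2 - k) = 0 := by
  have key : ∀ n, bowTies h (k + 3 + n) • torsionPoint k n =
      bowTies h (k + 3) • torsionPoint k n := by
    intro n
    obtain ⟨m, hm⟩ := exists_bowTies_sub h (k + 3 + n) (k + 3)
    rw [hm, add_zsmul, mul_comm, mul_zsmul, two_smul_torsionPoint, zsmul_zero, add_zero]
  rw [Finset.sum_filter, ← Equiv.sum_comp (Equiv.addLeft (k + 3))]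
  have hn : ∀ n, k + 3 + n + 2 - k = n := fun n => by clear key; revert k n; decide
  simp only [Equiv.coe_addLeft, ne_eq, add_eq_left, hn, key]
  rw [Fin.sum_univ_five]
  simp only [not_true_eq_false, if_false, zero_add]
  rw [if_pos (by decide), if_pos (by decide), if_pos (by decide), if_pos (by decide), ← zsmul_add,
    ← zsmul_add, ← zsmul_add, sum_torsionPoint, zsmul_zero]

theorem sum_faceCoeff_smul {k : Fin 5} (h : Height) (C : (E k).Point) :
    ∑ f, faceCoeff h f • (if f.1.1 = k + 3 then faceSign (k + 3) f.1.2 • C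
        else torsionPoint k (f.1.1 + 2 - k)) =
      (∑ f : Face with f.1.1 = k + 3, faceSign (k + 3) f.1.2 * faceCoeff h f) • C := by
  rw [← Finset.sum_filter_add_sum_filter_not _ (fun f : Face => f.1.1 = k + 3)]
  have h1 : ∑ f : Face with f.1.1 = k + 3, faceCoeff h f • (if f.1.1 = k + 3 then
      faceSign (k + 3) f.1.2 • C else torsionPoint k (f.1.1 + 2 - k)) =
      (∑ f : Face with f.1.1 = k + 3, faceSign (k + 3) f.1.2 * faceCoeff h f) • C := by
    rw [sum_zsmul_eq]
    refine Finset.sum_congr rfl fun f hf => ?_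
    rw [if_pos (Finset.mem_filter.mp hf).2, smul_smul, mul_comm]
  have h2 : ∑ f : Face with ¬ f.1.1 = k + 3, faceCoeff h f • (if f.1.1 = k + 3 then
      faceSign (k + 3) f.1.2 • C else torsionPoint k (f.1.1 + 2 - k)) = 0 := by
    rw [← sum_bowTies_smul_torsionPoint h k,
      ← Finset.sum_fiberwise_of_maps_to (t := Finset.univ.filter fun j => j ≠ k + 3)
        (g := fun f : Face => f.1.1) (by simp)]
    refine Finset.sum_congr rfl fun j hj => ?_
    have hj := (Finset.mem_filter.mp hj).2
    rw [bowTies, sum_zsmul_eq, Finset.filter_filter]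
    refine Finset.sum_congr ?_ fun f hf => ?_
    · ext f
      simp only [Finset.mem_filter, Finset.mem_univ, true_and, and_iff_right_iff_imp]
      rintro rfl
      exact hj
    · obtain rfl := (Finset.mem_filter.mp hf).2
      rw [if_neg hj]
  rw [h1, h2, add_zero]

theorem sum_vertexCoeff_smul {k : Fin 5} (h : Height) (C G : (E k).Point) :
    ∑ v, vertexCoeff h v • (faceSign (k + 3) v • (C + parity v • G)) =
      (∑ v, faceSign (k + 3) v * vertexCoeff h v) • C + amplitude (k + 3) h • G := by
  rw [amplitude, sum_zsmul_eq, sum_zsmul_eq, ← Finset.sum_add_distrib]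
  exact Finset.sum_congr rfl fun v _ => zsmul_zsmul_add _ _ _ _ _

/-- The image of the divisor of a height function is a multiple of a fixed point. -/
theorem nuHeight_eq_smul (ε : Embedding) (k : Fin 5) : ∃ G : (E k).Point,
    ¬ IsOfFinAddOrder G ∧ ∀ h, nuHeight ε h k = amplitude (k + 3) h • G := by
  obtain ⟨c, μ, hμ, hc, hv⟩ := ε.exists_coord
  set hs := nuY_coord_sq hμ hc k
  refine ⟨generator hs, generator_not_isOfFinAddOrder hs, fun h => ?_⟩
  have hvertex : ∀ v, nu k (ε.vertex v) =
      faceSign (k + 3) v • (centerPoint hs + parity v • generator hs) := by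
    intro v
    rw [nu_vertex hμ hc k (hv v), parity_eq]
    split_ifs
    · rw [neg_one_zsmul, ← whitePoint_sub_centerPoint, add_sub_cancel]
    · rw [one_zsmul, generator, add_sub_cancel]
  simp only [nuHeight_eq_sum, hvertex, nu_center ε hμ hc hv, sum_vertexCoeff_smul,
    sum_faceCoeff_smul]
  -- The multiples of the centre point from the vertices and from the faces cancel.
  rw [add_right_comm, ← add_zsmul, sum_vertexCoeff_add_sum_faceCoeff, zero_zsmul, zero_add]

/-! ### Existence of embeddings -/

theorem segmentTo_centerRatio_ne_zero {m : Fin 5} (hm : m ≠ 0) (s : ℝ) :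
    segmentTo (centerRatio m) s ≠ 0 := by
  intro h
  have h1 := congrArg Complex.im h
  have h2 := congrArg Complex.re h
  simp only [segmentTo, Complex.add_im, Complex.add_re, Complex.ofReal_im, Complex.ofReal_re,
    Complex.re_ofReal_mul, Complex.im_ofReal_mul, Complex.zero_im, Complex.zero_re, zero_add] at h1 h2
  rw [(mul_eq_zero.mp h1).resolve_right (centerRatio_im_ne_zero hm)] at h2
  norm_num at h2

/-- A white corner reached along the ray through the centre must agree with the end of an edge of
colour `J`. The factor `i ζ ^ 8` is the same for all coordinates, hence invisible in projective
space. -/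
theorem root_centerRatio {m : Fin 5} (hm : m ≠ 0) :
    root (centerRatio m) = Complex.I * zeta ^ 8 * edgeRoot (m + 2) := by
  have hsq : centerRatio m = (Complex.I * zeta ^ 8 * edgeRoot (m + 2)) ^ 2 := by
    rw [mul_pow, mul_pow, Complex.I_sq, edgeRoot, centerRatio, mul_assoc, neg_one_mul, ← pow_mul,
      ← pow_mul, ← pow_add, neg_zeta_pow]
    apply zeta_pow_congr
    clear hm
    revert m; decide
  rw [hsq, root_of_sq]
  have key : ∀ n l, 0 < l → l < 5 → (8 + n) % 10 = (l + 5) % 10 →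
      0 < (Complex.I * zeta ^ 8 * zeta ^ n).re := by
    intro n l h0 h5 h
    rw [mul_assoc, ← pow_add, zeta_pow_congr h, ← neg_zeta_pow]
    simpa using zeta_pow_im_pos h0 h5
  fin_cases m
  · exact absurd rfl hm
  · exact key 8 1 (by norm_num) (by norm_num) (by norm_num)
  · exact key 9 2 (by norm_num) (by norm_num) (by norm_num)
  · exact key 0 3 (by norm_num) (by norm_num) (by norm_num)
  · exact key 1 4 (by norm_num) (by norm_num) (by norm_num)

/-- Paths on the curve are given by square roots of the linear forms on the beach ball. -/
theorem joinedOver_of_sq {c : Fin 5 → ℂ} {μ : ℂ} (hc0 : ∀ i, c i ≠ 0)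
    (hc : ∀ i, c i ^ 2 = μ * (lead i * -branch i)) {v : Vertex}
    (hv : ¬ IsWhite v) {d : ℂ} {z : Fin 5 → ℂ} (hd : ∀ i, d = -branch i * z i) {s₀ s₁ : ℝ}
    {ρ : Fin 5 → ℝ → ℂ} (i₀ : Fin 5) (hρ0 : ∀ s, ρ i₀ s ≠ 0)
    (hρc : ∀ i, ContinuousOn (ρ i) (Set.uIcc s₀ s₁))
    (hρ : ∀ i, ∀ s ∈ Set.uIcc s₀ s₁, ρ i s ^ 2 = segmentTo (z i) s) {p q : Curve}
    (hp : Represents p fun i => vertexCoord c v i * ρ i s₀)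
    (hq : Represents q fun i => vertexCoord c v i * ρ i s₁) : JoinedOver d s₀ s₁ p q := by
  refine ⟨fun s i => vertexCoord c v i * ρ i s, fun s h => ?_, ?_, fun s hs => ?_, ?_, ?_⟩
  · exact mul_ne_zero (vertexCoord_ne_zero (hc0 i₀) v) (hρ0 s) (congrFun h i₀)
  · exact continuousOn_pi.mpr fun i => continuousOn_const.mul (hρc i)
  · have h : ∀ i, (vertexCoord c v i * ρ i s) ^ 2 =
        μ * (lead i * (s * d - branch i * ((1 - s : ℝ) : ℂ))) := by
      intro i
      rw [mul_pow, hρ i s hs, sub_branch_eq (hd i), vertexCoord_of_black hv, mul_pow,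
        coordSign_sq', hc]
      ring
    exact ⟨onCurve_of_sq_eq h, liesOver_of_sq_eq h⟩
  · exact hp.2
  · exact hq.2

theorem corner_eq_or (f : Face) (i l : Fin 4) (hi : ¬ IsWhite (corner f i))
    (hl : ¬ IsWhite (corner f l)) : corner f l = corner f i ∨
      corner f l = flipAt (flipAt (corner f i) f.1.1) (f.1.1 + 1) := by
  revert f i l; decide +kernel

theorem exists_corner_flipAt (f : Face) (i : Fin 4) : ∃ l, corner f l = flipAt (corner f i) f.1.1 := by
  fin_cases i
  · exact ⟨1, rfl⟩
  · exact ⟨0, (flipAt_flipAt_self _ _).symm⟩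
  · refine ⟨3, ?_⟩
    change flipAt f.1.2 _ = flipAt (flipAt (flipAt f.1.2 _) _) _
    rw [flipAt_comm f.1.2, flipAt_flipAt_self]
  · exact ⟨2, flipAt_comm _ _ _⟩

/-- The bits `J` and `J + 1` are separated by the cut at `i + 3` only if `i = J + 2`, apart from the
wrap-around `J = 4`, where exactly one of them always counts. So the centre does not depend on the
black corner used to compute it. -/
theorem coordSign_opposite {i J : Fin 5} (h : i ≠ J + 2) (v : Vertex) :
    coordSign i (flipAt (flipAt v J) (J + 1)) = (if J = 4 then -1 else 1) * coordSign i v := by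
  revert i J v; decide +kernel

theorem represents_centerCoord_opposite {c : Fin 5 → ℂ} {J : Fin 5} {v : Vertex}
    (hv : ¬ IsWhite v) {p : Curve} (hp : Represents p (centerCoord c J v)) :
    Represents p (centerCoord c J (flipAt (flipAt v J) (J + 1))) := by
  have hv' : ¬ IsWhite (flipAt (flipAt v J) (J + 1)) := by
    rw [isWhite_flipAt, isWhite_flipAt]; simpa using hv
  have h : centerCoord c J (flipAt (flipAt v J) (J + 1)) =
      (if J = 4 then -1 else 1 : ℂ) • centerCoord c J v := by
    funext i
    rw [Pi.smul_apply, centerCoord, centerCoord]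
    split_ifs with hi hJ hJ
    · simp
    · simp
    · rw [vertexCoord_of_black hv', vertexCoord_of_black hv, coordSign_opposite hi, if_pos hJ]
      push_cast; simp
    · rw [vertexCoord_of_black hv', vertexCoord_of_black hv, coordSign_opposite hi, if_neg hJ]
      simp
  rw [h]
  exact hp.smul (by split_ifs <;> norm_num)

section Construction

variable {c : Fin 5 → ℂ} {μ : ℂ}

theorem onCurve_vertexCoord (hc : ∀ i, c i ^ 2 = μ * (lead i * -branch i)) (v : Vertex) :
    OnCurve (vertexCoord c v) := by
  by_cases hv : IsWhite v
  · refine onCurve_of_sq_eq (a := 1) (b := 0) (μ := μ * zeta ^ 8) fun i => ?_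
    have h : -branch i * (zeta ^ (9 * ((i + 3 : Fin 5) : ℕ))) ^ 2 = zeta ^ 8 := by
      rw [branch, neg_zeta_pow, ← pow_mul, ← pow_add]
      apply zeta_pow_congr
      revert i; decide
    rw [vertexCoord, if_pos hv, mul_pow, mul_pow, coordSign_sq', hc]
    linear_combination μ * lead i * h
  · refine onCurve_of_sq_eq (a := 0) (b := 1) (μ := μ) fun i => ?_
    rw [vertexCoord_of_black hv, mul_pow, coordSign_sq', hc]
    ring

theorem onCurve_centerCoord (hc : ∀ i, c i ^ 2 = μ * (lead i * -branch i)) {J : Fin 5}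
    {v : Vertex} (hv : ¬ IsWhite v) : OnCurve (centerCoord c J v) := by
  refine onCurve_of_sq_eq (a := ((1 / 2 : ℝ) : ℂ) * zeta ^ (2 * (J : ℕ) + 3))
    (b := ((1 - 1 / 2 : ℝ) : ℂ)) (μ := μ) fun i => ?_
  rw [centerCoord_sq hc hv, sub_branch_eq (center_direction i J), segmentTo]
  push_cast; ring

theorem joinedOver_edge (hc0 : ∀ i, c i ≠ 0) (hc : ∀ i, c i ^ 2 = μ * (lead i * -branch i))
    {v : Vertex} (hv : ¬ IsWhite v) (j : Fin 5) {p q : Curve} (hp : Represents p (vertexCoord c v))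
    (hq : Represents q (vertexCoord c (flipAt v j))) :
    JoinedOver (zeta ^ (2 * (j : ℕ) + 2)) 0 1 p q := by
  -- The coordinate `j - 1` is constant along the edge. It keeps the path nonzero for every real
  -- `s`, also outside `[0, 1]`.
  refine joinedOver_of_sq hc0 hc hv (edge_direction · j)
    (ρ := fun i s => root (segmentTo (edgeRoot (j - i - 1) ^ 2) s)) (j - 1) ?_ ?_ ?_ ?_ ?_
  · intro s
    have : segmentTo (edgeRoot (j - (j - 1) - 1) ^ 2) s = 1 := by
      rw [sub_sub_cancel, sub_self, segmentTo]
      simp [edgeRoot]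
    rw [this, root_one]
    exact one_ne_zero
  · intro i
    rw [Set.uIcc_of_le zero_le_one]
    exact continuousOn_root_segmentTo (sq_mem_slitPlane (edgeRoot_re_pos _))
  · exact fun i s _ => root_sq _
  · simpa only [segmentTo_zero, root_one, mul_one] using hp
  · have h : (fun i => vertexCoord c v i * root (segmentTo (edgeRoot (j - i - 1) ^ 2) 1)) =
        (edgeScale j)⁻¹ • vertexCoord c (flipAt v j) := by
      funext i
      rw [Pi.smul_apply, smul_eq_mul, vertexCoord_flipAt c hv, segmentTo_one,
        root_of_sq (edgeRoot_re_pos _), inv_mul_cancel_left₀ (edgeScale_ne_zero j), mul_comm]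
    rw [h]
    exact hq.smul (inv_ne_zero (edgeScale_ne_zero j))

theorem joinedOver_center (hc0 : ∀ i, c i ≠ 0) (hc : ∀ i, c i ^ 2 = μ * (lead i * -branch i))
    {v : Vertex} (hv : ¬ IsWhite v) (J : Fin 5) {s₀ : ℝ} (hs₀ : s₀ ∈ Set.Icc (0 : ℝ) 1)
    {g : ℝ → ℂ} (hg : Continuous g) (hgs : ∀ s ∈ Set.uIcc s₀ (1 / 2), g s ^ 2 = 1 - 2 * s)
    {p q : Curve} (hp : Represents p fun i => vertexCoord c v i *
      if i = J + 2 then g s₀ else root (segmentTo (centerRatio (J + 2 - i)) s₀))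
    (hq : Represents q (centerCoord c J v)) :
    JoinedOver (zeta ^ (2 * (J : ℕ) + 3)) s₀ (1 / 2) p q := by
  have hJ : J ≠ J + 2 := by clear * -; revert J; decide
  refine joinedOver_of_sq hc0 hc hv (center_direction · J)
    (ρ := fun i s => if i = J + 2 then g s else root (segmentTo (centerRatio (J + 2 - i)) s))
    J ?_ ?_ ?_ hp ?_
  · intro s
    simp only [if_neg hJ]
    exact root_ne_zero (segmentTo_centerRatio_ne_zero (sub_ne_zero_of_ne hJ) s)
  · intro i
    split_ifs with hi
    · exact hg.continuousOn
    · exact (continuousOn_root_segmentTo (centerRatio_mem (sub_ne_zero_of_ne hi))).mono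
        (Set.uIcc_subset_Icc hs₀ ⟨by norm_num, by norm_num⟩)
  · intro i s hs
    split_ifs with hi
    · rw [hgs s hs, hi, sub_self, centerRatio_zero, segmentTo]
      push_cast; ring
    · exact root_sq _
  · have h : g (1 / 2) = 0 := by
      have := hgs _ Set.right_mem_uIcc
      exact (pow_eq_zero_iff two_ne_zero).mp (this.trans (by norm_num))
    convert hq using 1
    funext i
    rw [centerCoord]
    split_ifs
    · rw [h, mul_zero]
    · rfl

theorem joinedOver_center_black (hc0 : ∀ i, c i ≠ 0)
    (hc : ∀ i, c i ^ 2 = μ * (lead i * -branch i)) {v : Vertex} (hv : ¬ IsWhite v) (J : Fin 5)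
    {p q : Curve} (hp : Represents p (vertexCoord c v)) (hq : Represents q (centerCoord c J v)) :
    JoinedOver (zeta ^ (2 * (J : ℕ) + 3)) 0 (1 / 2) p q := by
  -- The coordinate `J + 2` needs a root of `1 - 2 s` that vanishes at the centre; from the white
  -- side the radicand is negative and a factor `i` appears.
  refine joinedOver_center hc0 hc hv J ⟨le_rfl, zero_le_one⟩
    (g := fun s => (Real.sqrt (1 - 2 * s) : ℂ)) (by fun_prop) ?_ ?_ hq
  · intro s hs
    rw [Set.uIcc_of_le (by norm_num)] at hs
    rw [← Complex.ofReal_pow, Real.sq_sqrt (by linarith [hs.2])]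
    push_cast; ring
  · convert hp using 1
    funext i
    split_ifs <;> simp [segmentTo_zero, root_one]

theorem joinedOver_center_white (hc0 : ∀ i, c i ≠ 0)
    (hc : ∀ i, c i ^ 2 = μ * (lead i * -branch i)) {v : Vertex} (hv : ¬ IsWhite v) (J : Fin 5)
    {p q : Curve} (hp : Represents p (vertexCoord c (flipAt v J)))
    (hq : Represents q (centerCoord c J v)) :
    JoinedOver (zeta ^ (2 * (J : ℕ) + 3)) 1 (1 / 2) p q := by
  refine joinedOver_center hc0 hc hv J ⟨zero_le_one, le_rfl⟩
    (g := fun s => Complex.I * (Real.sqrt (2 * s - 1) : ℂ)) (by fun_prop) ?_ ?_ hq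
  · intro s hs
    rw [Set.uIcc_of_ge (by norm_num)] at hs
    rw [mul_pow, Complex.I_sq, ← Complex.ofReal_pow, Real.sq_sqrt (by linarith [hs.1])]
    push_cast; ring
  · have hI : Complex.I * zeta ^ 8 * (edgeScale J)⁻¹ ≠ 0 :=
      mul_ne_zero (mul_ne_zero Complex.I_ne_zero (pow_ne_zero _ zeta_ne_zero))
        (inv_ne_zero (edgeScale_ne_zero J))
    convert hp.smul hI using 1
    funext i
    have h : (if i = J + 2 then Complex.I * (Real.sqrt (2 * 1 - 1) : ℂ) else
        root (segmentTo (centerRatio (J + 2 - i)) 1)) =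
        Complex.I * zeta ^ 8 * edgeRoot (J - i - 1) := by
      split_ifs with hi
      · have h2 : J - i - 1 = 2 := by clear hp hq; subst hi; clear * -; revert J; decide
        have h3 : zeta ^ 8 * edgeRoot 2 = 1 := by
          change zeta ^ 8 * zeta ^ 2 = 1
          linear_combination (zeta ^ 5 - 1) * zeta_pow_five
        rw [h2, mul_assoc, h3]
        norm_num
      · have h2 : J + 2 - i + 2 = J - i - 1 := by clear * -; revert i J; decide
        rw [segmentTo_one, root_centerRatio (sub_ne_zero_of_ne hi), h2]
    rw [h, Pi.smul_apply, smul_eq_mul, vertexCoord_flipAt c hv]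
    have := edgeScale_ne_zero J
    field_simp

end Construction

theorem nonempty_embedding : Nonempty Embedding := by
  set c : Fin 5 → ℂ := fun i => root (lead i * -branch i)
  have hc : ∀ i, c i ^ 2 = 1 * (lead i * -branch i) := fun i => by rw [root_sq, one_mul]
  have hc0 := coord_ne_zero one_ne_zero hc
  choose V hV using fun v => exists_represents (vertexCoord_fun_ne_zero hc0 v)
    (onCurve_vertexCoord hc v)
  choose b hb using exists_black_corner
  choose C hC using fun f => exists_represents
    (centerCoord_fun_ne_zero hc0 f.1.1 (corner f (b f))) (onCurve_centerCoord hc (hb f))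
  have hC' : ∀ f i, ¬ IsWhite (corner f i) →
      Represents (C f) (centerCoord c f.1.1 (corner f i)) := by
    intro f i hi
    rcases corner_eq_or f (b f) i (hb f) hi with h | h <;> rw [h]
    · exact hC f
    · exact represents_centerCoord_opposite (hb f) (hC f)
  refine ⟨⟨V, C, fun v j hv => joinedOver_edge hc0 hc hv j (hV _) (hV _), fun f i hv =>
    joinedOver_center_black hc0 hc hv _ (hV _) (hC' f i hv), fun f i hv => ?_⟩⟩
  -- The path from a white corner is described by the coordinates of the black corner across the
  -- edge of the first colour of the face.
  obtain ⟨l, hl⟩ := exists_corner_flipAt f i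
  have hb : ¬ IsWhite (corner f l) := by rw [hl, isWhite_flipAt]; simpa using hv
  refine joinedOver_center_white hc0 hc hb _ ?_ (hC' f l hb)
  rw [hl, flipAt_flipAt_self]
  exact hV _

end Adinkra

theorem mainTheorem1 :
    Nonempty Adinkra.Embedding ∧
    ∀ (ε : Adinkra.Embedding) (hfe h₁ : Adinkra.Height) (t : Adinkra.Vertex),
      Adinkra.IsFullyExtended hfe → Adinkra.IsTopVertex hfe t → Adinkra.Lowers t hfe h₁ →
      ∀ k : Fin 5,
        {P | ∃ h : Adinkra.Height, P = Adinkra.nuHeight ε h k} =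
          {P | ∃ a : ℤ, -8 ≤ a ∧ a ≤ 8 ∧ P = a • Adinkra.nuHeight ε h₁ k} ∧
        ¬ IsOfFinAddOrder (Adinkra.nuHeight ε h₁ k) ∧
        ∀ (h h' : Adinkra.Height) (v : Adinkra.Vertex),
          Adinkra.Lowers v h h' ∨ Adinkra.Lowers v h' h →
          ∃ a a' : ℤ, Adinkra.nuHeight ε h k = a • Adinkra.nuHeight ε h₁ k ∧
            Adinkra.nuHeight ε h' k = a' • Adinkra.nuHeight ε h₁ k ∧ |a - a'| = 1 := by
  refine ⟨Adinkra.nonempty_embedding, fun ε hfe h₁ t hfull _ hlow k => ?_⟩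
  obtain ⟨G, hG, hnu⟩ := Adinkra.nuHeight_eq_smul ε k
  -- The amplitude of `h₁` is one step away from zero, so its image is the generator up to the sign
  -- `e`. Multiplication by `e` preserves the interval from `-8` to `8`.
  obtain ⟨e, he, hh₁⟩ : ∃ e : ℤ, |e| = 1 ∧ Adinkra.amplitude (k + 3) h₁ = e := by
    refine ⟨_, ?_, rfl⟩
    have h1 := Adinkra.abs_amplitude_sub_of_lowers (k + 3) hlow
    rwa [Adinkra.amplitude_of_isFullyExtended _ hfull, zero_sub, abs_neg] at h1
  have hee : e * e = 1 := by rw [← abs_mul_abs_self, he, one_mul]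
  have hmul : ∀ h, Adinkra.nuHeight ε h k =
      (e * Adinkra.amplitude (k + 3) h) • Adinkra.nuHeight ε h₁ k := by
    intro h
    rw [hnu, hnu h₁, hh₁, smul_smul]
    congr 1
    linear_combination -Adinkra.amplitude (k + 3) h * hee
  have habs : ∀ a : ℤ, |e * a| = |a| := fun a => by rw [abs_mul, he, one_mul]
  refine ⟨Set.ext fun P => ⟨?_, ?_⟩, ?_, ?_⟩
  · rintro ⟨h, rfl⟩
    have := Adinkra.abs_amplitude_le (k + 3) h
    rw [← habs, abs_le] at this
    exact ⟨_, this.1, this.2, hmul h⟩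
  · rintro ⟨a, h1, h2, rfl⟩
    have h3 := abs_le.mp ((habs a).trans_le (abs_le.mpr ⟨h1, h2⟩))
    obtain ⟨h, hh⟩ := Adinkra.exists_amplitude_eq (k + 3) h3.1 h3.2
    refine ⟨h, ?_⟩
    rw [hmul h, hh, ← mul_assoc, hee, one_mul]
  · rw [hnu h₁, hh₁]
    rcases (abs_eq zero_le_one).mp he with rfl | rfl
    · rwa [one_zsmul]
    · rwa [neg_one_zsmul, isOfFinAddOrder_neg_iff]
  · intro h h' v hl
    refine ⟨_, _, hmul h, hmul h', ?_⟩
    rw [← mul_sub, habs]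
    rcases hl with hl | hl
    · exact Adinkra.abs_amplitude_sub_of_lowers _ hl
    · rw [abs_sub_comm]
      exact Adinkra.abs_amplitude_sub_of_lowers _ hl
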